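/- Let $q$ be a prime power and let $\ell \ge 2$ be an integer. Write $\bar x = x^q$ for $x \in \mathbb{F}_{q^2}$, and let $\mathbb{H}^{\ell}(\mathbb{F}_{q^2})$ be the set of all $\ell\times\ell$ Hermitian matrices over $\mathbb{F}_{q^2}$, i.e. of all $P=(P_{i,j})$ with $P_{i,j} = P_{j,i}^{\,q}$ for all $i,j$. Let $X = (X_{i,j})$ be the generic $\ell\times\ell$ matrix of indeterminates; for $I,J\subseteq\{1,\dots,\ell\}$ with $\#I=\#J$ let $\det_{I,J}(X)$ be the determinant of the submatrix of $X$ on the rows $I$ and columns $J$ (equal to $1$ for $I=J=\emptyset$). Let $\mathcal{F}(\ell)\subseteq \mathbb{F}_{q^2}[X]$ be the space of all $\mathbb{F}_{q^2}$-linear combinations of the minors $\det_{I,J}(X)$. The affine Hermitian Grassmann code is $$C^{\mathbb{H}}(\ell) = \bigl\{ (f(P))_{P\in\mathbb{H}^{\ell}(\mathbb{F}_{q^2})} \;:\; f\in\mathcal{F}(\ell)\bigr\},$$ where $f(P)$ is obtained from $f$ by replacing each $X_{i,j}$ by $P_{i,j}$. Its minimum distance $d(C^{\mathbb{H}}(\ell))$,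 the least Hamming distance between two distinct codewords, is $$d(C^{\mathbb{H}}(\ell)) = q^{\ell^2}-q^{\ell^2-1}-q^{\ell^2-3}.$$ Moreover, $f = \det_{\{1,2\},\{1,2\}}(X) + 1$ belongs to $\mathcal{F}(\ell)$, and the codeword $(f(P))_P$ has exactly $q^{\ell^2}-q^{\ell^2-1}-q^{\ell^2-3}$ nonzero coordinates. -/

import Mathlib

/-- The minor `det_{I,J}(M)`: the determinant of the submatrix of `M` on the rows `I` and the
columns `J`, both listed in increasing order. For `I = J = ∅` it is `1`. -/
def minorDet {R : Type*} [CommRing R] {l : ℕ} (M : Matrix (Fin l) (Fin l) R)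
    (I J : Finset (Fin l)) (h : I.card = J.card) : R :=
  (M.submatrix (I.orderEmbOfFin rfl) (J.orderEmbOfFin h.symm)).det

/-- The conjugate transpose `M^*` of a matrix over a field with `q ^ 2` elements, the conjugate
of `x` being `x ^ q`: the `(i, j)` entry of `M^*` is `(M j i) ^ q`. -/
def conjTranspose (q : ℕ) {K : Type*} [Field K] {l : ℕ} (M : Matrix (Fin l) (Fin l) K) :
    Matrix (Fin l) (Fin l) K :=
  Matrix.of fun i j => M j i ^ q

/-- The set of all `l × l` Hermitian matrices (`M^* = M`) over a field `K` with `q ^ 2` elements. -/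
abbrev HermitianMatrix (q l : ℕ) (K : Type*) [Field K] : Type _ :=
  {M : Matrix (Fin l) (Fin l) K // conjTranspose q M = M}

noncomputable instance (q l : ℕ) (K : Type*) [Field K] [Finite K] :
    Fintype (HermitianMatrix q l K) :=
  Fintype.ofFinite _

/-- The space `F(l)` of `K`-linear combinations of all minors (of all sizes, the empty one
included) of the generic matrix `X = [X_{i,j}]`. -/
noncomputable def minorSpace (l : ℕ) (K : Type*) [Field K] :
    Submodule K (MvPolynomial (Fin l × Fin l) K) :=
  Submodule.span K {p | ∃ (I J : Finset (Fin l)) (h : I.card = J.card),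
    p = minorDet (Matrix.mvPolynomialX (Fin l) (Fin l) K) I J h}

/-- The evaluation map: `f ↦ (f(P))_P`, with `P` running through all Hermitian matrices and
`X_{i,j}` replaced by `P_{i,j}`. -/
noncomputable def hermitianEval (q l : ℕ) (K : Type*) [Field K] :
    MvPolynomial (Fin l × Fin l) K →ₗ[K] (HermitianMatrix q l K → K) :=
  LinearMap.pi fun P =>
    (MvPolynomial.aeval (R := K) fun ij : Fin l × Fin l => P.1 ij.1 ij.2).toLinearMap

/-- The affine Hermitian Grassmann code: the image of `F(l)` under the evaluation map. -/
noncomputable def affineHermitianGrassmannCode (q l : ℕ) (K : Type*) [Field K] :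
    Submodule K (HermitianMatrix q l K → K) :=
  (minorSpace l K).map (hermitianEval q l K)

/-- The minimum distance of a code: the least Hamming distance between two distinct codewords
(by convention `0` if there are no two distinct codewords). -/
noncomputable def minDist {ι A : Type*} [Fintype ι] [DecidableEq A] (C : Set (ι → A)) : ℕ :=
  sInf {d | ∃ x ∈ C, ∃ y ∈ C, x ≠ y ∧ hammingDist x y = d}

/-!
The weight of a codeword is `q ^ l ^ 2` minus the number of Hermitian zeros of the function `f` that
defines it, so the minimum distance amounts to the bound `q ^ l ^ 2 * (1 / q + 1 / q ^ 3)` for the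
number of Hermitian zeros of a linear combination of minors, not zero on all Hermitian matrices
(`RankOneAffine.hermZeros_le`), and to the fact that the leading `2 × 2` minor plus one attains it
(`hermZeros_leading_minor`).

Only one property of linear combinations of minors is used: the increment of `f` along a rank-one
matrix `u vᵀ` is bilinear in `u` and `v` at every base point (`RankOneAffine`). This class is stable
under increments, congruences `X ↦ P X P*`, and restriction to matrices with prescribed first row
and column. Replacing `f` by `θ f + (θ f)*` one may also assume that `f` is fixed by the conjugation
on Hermitian matrices (`HermFun`, `RankOneAffine.exists_hermFun`).

The bound is proved by induction on the dimension, splitting the Hermitian matrices according to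
their first row and column (`hermZeros_eq_sum`). Take a longest list of vectors `w` such that the
iterated increment of `f` along the matrices `w w*` is nonzero. The vectors are independent. If they
do not span, a congruence moves them into the hyperplane `x 0 = 0`; then no restriction of `f` to a
prescribed first row and column vanishes identically, and the bound follows from the previous
dimension. If they span, a congruence makes them the coordinate vectors, which says that the
determinant has a nonzero coefficient in `f` (`HermFun.dichotomy`).

In the second case the same holds for the restrictions of `f` unless the corner entry has one
exceptional value (`HermFun.exists_topDiff_bordered`), and at that value at most `q + 1`
restrictions vanish identically (`HermFun.card_bordered_eq_zero_le`). These vanishing restrictions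
would spoil the induction, so a better bound is carried along for functions in which the determinant
occurs, with a gain of `(q ^ 2 - q + 1) / q ^ (2 * l)`, which pays for them at the next step
(`hermZeros_topDiff_step`). The better bound starts in dimension three, where `f` can be brought by
a translation and a congruence into a form with at most one vanishing restriction
(`HermFun.hermZeros_dim_three_of_topDiff_ne`).
-/

/-! ### The conjugation of a quadratic extension -/

/-- `σ` is the conjugation `x ↦ x ^ q` of a field with `q ^ 2` elements. -/
structure QuadConj {K : Type*} [Field K] [Fintype K] (q : ℕ) (σ : K →+* K) : Prop where
  two_le : 2 ≤ q
  card : Fintype.card K = q ^ 2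
  apply : ∀ x, σ x = x ^ q

namespace QuadConj

variable {K : Type*} [Field K] [Fintype K] {q : ℕ} {σ : K →+* K}

theorem invol (h : QuadConj q σ) (x : K) : σ (σ x) = x := by
  rw [h.apply, h.apply, ← pow_mul, ← sq, ← h.card, FiniteField.pow_card]

theorem card_roots_le [DecidableEq K] (p : Polynomial K) (hp : p ≠ 0) (P : K → Prop)
    [DecidablePred P] (hP : ∀ t, P t → p.eval t = 0) :
    (Finset.univ.filter P).card ≤ p.natDegree := by
  refine le_trans (Finset.card_le_card ?_) (p.roots.toFinset_card_le.trans (p.card_roots'))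
  intro t ht
  simp only [Finset.mem_filter, Finset.mem_univ, true_and] at ht
  simp [hp, hP t ht]

/-- A nonzero function `t ↦ α * σ t + β * t + γ` has at most `q` zeros, being a polynomial of degree
at most `q` in `t`. -/
theorem card_linear_le [DecidableEq K] (h : QuadConj q σ) {α β γ : K}
    (h0 : α ≠ 0 ∨ β ≠ 0 ∨ γ ≠ 0) :
    (Finset.univ.filter fun t : K => α * σ t + β * t + γ = 0).card ≤ q := by
  have h2 := h.two_le
  let p : Polynomial K := Polynomial.C α * Polynomial.X ^ q + Polynomial.C β * Polynomial.X
    + Polynomial.C γ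
  have hp : p ≠ 0 := by
    intro hp
    have e : ∀ k, p.coeff k = 0 := by simp [hp]
    have e0 := e 0
    have e1 := e 1
    have eq := e q
    have q0 : q ≠ 0 := by omega
    have q1 : q ≠ 1 := by omega
    simp [p, Polynomial.coeff_X, Polynomial.coeff_C, Polynomial.coeff_X_pow, q0, q0.symm,
      q1.symm] at e0 e1 eq
    tauto
  refine (card_roots_le p hp _ ?_).trans ?_
  · intro t ht
    simp only [p, Polynomial.eval_add, Polynomial.eval_mul, Polynomial.eval_C, Polynomial.eval_pow,
      Polynomial.eval_X, ← h.apply]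
    exact ht
  · simp only [p]
    compute_degree
    omega

/-- The norm form `t ↦ t * σ t` has degree `q + 1` in `t`, whence the bound. -/
theorem card_circle_le [DecidableEq K] (h : QuadConj q σ) {c κ κ' e : K} (hc : c ≠ 0) :
    (Finset.univ.filter fun t : K => c * (t * σ t) = κ * t + κ' * σ t + e).card ≤ q + 1 := by
  have h2 := h.two_le
  let p : Polynomial K := Polynomial.C c * Polynomial.X ^ (q + 1) -
    (Polynomial.C κ * Polynomial.X + Polynomial.C κ' * Polynomial.X ^ q + Polynomial.C e)
  have hp : p ≠ 0 := by
    intro hp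
    have e : p.coeff (q + 1) = 0 := by simp [hp]
    have q0 : q ≠ 0 := by omega
    have q1 : ¬ q + 1 ≤ 1 := by omega
    simp [p, Polynomial.coeff_C, Polynomial.coeff_X_pow, q0] at e
    tauto
  refine (card_roots_le p hp _ ?_).trans ?_
  · intro t ht
    simp only [p, Polynomial.eval_add, Polynomial.eval_sub, Polynomial.eval_mul, Polynomial.eval_C,
      Polynomial.eval_pow, Polynomial.eval_X, pow_succ t q, ← h.apply]
    linear_combination ht
  · simp only [p]
    compute_degree

/-- The two coefficients of a `σ`-polynomial vanishing everywhere are zero. -/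
theorem eq_zero_of_linear (h : QuadConj q σ) {α β : K} (h0 : ∀ t, α * σ t + β * t = 0) :
    α = 0 ∧ β = 0 := by
  classical
  by_contra hne
  have hc := h.card_linear_le (α := α) (β := β) (γ := 0) (by tauto)
  have : (Finset.univ.filter fun t : K => α * σ t + β * t + 0 = 0) = Finset.univ := by
    ext t; simp [h0]
  rw [this, Finset.card_univ, h.card] at hc
  nlinarith [h.two_le]

end QuadConj

/-- The subfield fixed by the conjugation, as a type. -/
abbrev FixedBy {K : Type*} [Field K] (σ : K →+* K) : Type _ := {x : K // σ x = x}

namespace QuadConj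

variable {K : Type*} [Field K] [Fintype K] {q : ℕ} {σ : K →+* K}

theorem card_fixed [DecidableEq K] (h : QuadConj q σ) : Fintype.card (FixedBy σ) = q := by
  have h2 := h.two_le
  apply le_antisymm
  · rw [Fintype.card_subtype]
    refine le_trans (Finset.card_le_card ?_)
      (h.card_linear_le (α := 1) (β := -1) (γ := 0) (by simp))
    intro t ht
    simp only [Finset.mem_filter, Finset.mem_univ, true_and] at ht ⊢
    rw [ht]; ring
  · -- the fibres of the trace `t ↦ t + σ t` have at most `q` elements
    have hmap : ∀ t ∈ (Finset.univ : Finset K),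
        (⟨t + σ t, by rw [map_add, h.invol, add_comm]⟩ : FixedBy σ) ∈ Finset.univ := by simp
    have := Finset.card_le_mul_card_image_of_maps_to hmap q (by
      intro b _
      refine le_trans (Finset.card_le_card ?_)
        (h.card_linear_le (α := 1) (β := 1) (γ := -b.1) (by simp))
      intro t ht
      simp only [Finset.mem_filter, Finset.mem_univ, true_and] at ht ⊢
      rw [← ht]; ring)
    rw [Finset.card_univ, Finset.card_univ, h.card, sq] at this
    exact Nat.le_of_mul_le_mul_left this (by omega)

/-- The norm-one elements: the fibres of the norm over the nonzero fixed elements have at most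
`q + 1` elements each, and they partition `q ^ 2 - 1` elements. -/
theorem card_norm_one [DecidableEq K] (h : QuadConj q σ) :
    (Finset.univ.filter fun t : K => t * σ t = 1).card = q + 1 := by
  have h2 := h.two_le
  have hle : ∀ e : K, (Finset.univ.filter fun t : K => t * σ t = e).card ≤ q + 1 := by
    intro e
    simpa using h.card_circle_le (c := 1) (κ := 0) (κ' := 0) (e := e) one_ne_zero
  apply le_antisymm (hle 1)
  by_contra hlt
  push Not at hlt
  have hσ0 : ∀ t : K, t ≠ 0 → σ t ≠ 0 := fun t ht => by simpa using ht
  let s : Finset K := Finset.univ.erase 0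
  let F : Finset K := (Finset.univ.filter fun x : K => σ x = x).erase 0
  have hF : F.card = q - 1 := by
    have := h.card_fixed
    rw [Fintype.card_subtype] at this
    rw [Finset.card_erase_of_mem (by simp), this]
  have hs : s.card = q ^ 2 - 1 := by
    rw [Finset.card_erase_of_mem (Finset.mem_univ _), Finset.card_univ, h.card]
  have hmaps : ∀ t ∈ s, t * σ t ∈ F := by
    intro t ht
    have ht0 : t ≠ 0 := Finset.ne_of_mem_erase ht
    simp [F, ht0, h.invol, mul_comm]
  have hsum := Finset.card_eq_sum_card_fiberwise hmaps
  have h1F : (1 : K) ∈ F := by simp [F]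
  have : ∑ b ∈ F, (s.filter fun t => t * σ t = b).card < ∑ _b ∈ F, (q + 1) := by
    apply Finset.sum_lt_sum
    · intro b _
      exact (Finset.card_le_card (Finset.filter_subset_filter _ (Finset.subset_univ _))).trans
        (hle b)
    · exact ⟨1, h1F, lt_of_le_of_lt (Finset.card_le_card
        (Finset.filter_subset_filter _ (Finset.subset_univ _))) hlt⟩
  rw [← hsum, hs, Finset.sum_const, hF, smul_eq_mul] at this
  have e : (q - 1) * (q + 1) = q ^ 2 - 1 := by
    obtain ⟨k, rfl⟩ : ∃ k, q = k + 2 := ⟨q - 2, by omega⟩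
    rw [show k + 2 - 1 = k + 1 by omega, eq_tsub_iff_add_eq_of_le (by nlinarith)]
    ring
  omega

end QuadConj

section RankOne

open Matrix

/-! ### Rank-one affine functions -/

/-- The increment of a matrix function along the rank-one matrix `u vᵀ`. -/
def rankOneDiff {K : Type*} [Field K] {n : ℕ} (u v : Fin n → K)
    (f : Matrix (Fin n) (Fin n) K → K) : Matrix (Fin n) (Fin n) K → K :=
  fun X => f (X + vecMulVec u v) - f X

/-- Functions on square matrices whose increment along `u vᵀ` is bilinear in `u` and `v`, at every
base point. -/
structure RankOneAffine {K : Type*} [Field K] {n : ℕ} (f : Matrix (Fin n) (Fin n) K → K) :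
    Prop where
  add_left : ∀ u u' v, rankOneDiff (u + u') v f = rankOneDiff u v f + rankOneDiff u' v f
  smul_left : ∀ (c : K) u v, rankOneDiff (c • u) v f = c • rankOneDiff u v f
  add_right : ∀ u v v', rankOneDiff u (v + v') f = rankOneDiff u v f + rankOneDiff u v' f
  smul_right : ∀ (c : K) u v, rankOneDiff u (c • v) f = c • rankOneDiff u v f

section

variable {K : Type*} [Field K] {n : ℕ} {f g : Matrix (Fin n) (Fin n) K → K}

theorem apply_add_vecMulVec (f : Matrix (Fin n) (Fin n) K → K) (X : Matrix (Fin n) (Fin n) K)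
    (u v : Fin n → K) : f (X + vecMulVec u v) = f X + rankOneDiff u v f X := by
  simp [rankOneDiff]

theorem rankOneDiff_add (u v : Fin n → K) (f g : Matrix (Fin n) (Fin n) K → K) :
    rankOneDiff u v (f + g) = rankOneDiff u v f + rankOneDiff u v g := by
  ext X; simp [rankOneDiff]; ring

theorem rankOneDiff_sub (u v : Fin n → K) (f g : Matrix (Fin n) (Fin n) K → K) :
    rankOneDiff u v (f - g) = rankOneDiff u v f - rankOneDiff u v g := by
  ext X; simp [rankOneDiff]; ring

theorem rankOneDiff_smul (u v : Fin n → K) (c : K) (f : Matrix (Fin n) (Fin n) K → K) :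
    rankOneDiff u v (c • f) = c • rankOneDiff u v f := by
  ext X; simp [rankOneDiff]; ring

theorem rankOneDiff_zero (u v : Fin n → K) :
    rankOneDiff u v (0 : Matrix (Fin n) (Fin n) K → K) = 0 := by
  ext X; simp [rankOneDiff]

theorem rankOneDiff_const (u v : Fin n → K) (c : K) :
    rankOneDiff u v (fun _ : Matrix (Fin n) (Fin n) K => c) = 0 := by
  ext X; simp [rankOneDiff]

theorem rankOneDiff_comm (u v u' v' : Fin n → K) (f : Matrix (Fin n) (Fin n) K → K) :
    rankOneDiff u v (rankOneDiff u' v' f) = rankOneDiff u' v' (rankOneDiff u v f) := by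
  ext X
  simp only [rankOneDiff, add_right_comm X]
  ring

namespace RankOneAffine

theorem add (hf : RankOneAffine f) (hg : RankOneAffine g) : RankOneAffine (f + g) where
  add_left u u' v := by simp only [rankOneDiff_add, hf.add_left, hg.add_left]; ring
  smul_left c u v := by simp only [rankOneDiff_add, hf.smul_left, hg.smul_left, smul_add]
  add_right u u' v := by simp only [rankOneDiff_add, hf.add_right, hg.add_right]; ring
  smul_right c u v := by simp only [rankOneDiff_add, hf.smul_right, hg.smul_right, smul_add]

theorem smul (hf : RankOneAffine f) (c : K) : RankOneAffine (c • f) where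
  add_left u u' v := by simp only [rankOneDiff_smul, hf.add_left, smul_add]
  smul_left d u v := by simp only [rankOneDiff_smul, hf.smul_left, smul_comm c d]
  add_right u u' v := by simp only [rankOneDiff_smul, hf.add_right, smul_add]
  smul_right d u v := by simp only [rankOneDiff_smul, hf.smul_right, smul_comm c d]

theorem sub (hf : RankOneAffine f) (hg : RankOneAffine g) : RankOneAffine (f - g) := by
  have := hf.add (hg.smul (-1))
  rwa [neg_one_smul, ← sub_eq_add_neg] at this

theorem const (c : K) : RankOneAffine (fun _ : Matrix (Fin n) (Fin n) K => c) where
  add_left u u' v := by simp [rankOneDiff_const]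
  smul_left d u v := by simp [rankOneDiff_const]
  add_right u u' v := by simp [rankOneDiff_const]
  smul_right d u v := by simp [rankOneDiff_const]

/-- The class is stable under maps carrying rank-one increments to rank-one increments. -/
theorem comp {m : ℕ} (hf : RankOneAffine f)
    (φ : Matrix (Fin m) (Fin m) K → Matrix (Fin n) (Fin n) K)
    (A B : (Fin m → K) →ₗ[K] (Fin n → K))
    (hφ : ∀ X u v, φ (X + vecMulVec u v) = φ X + vecMulVec (A u) (B v)) :
    RankOneAffine (f ∘ φ) := by
  have key : ∀ u v, rankOneDiff u v (f ∘ φ) = rankOneDiff (A u) (B v) f ∘ φ := by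
    intro u v; ext X; simp [rankOneDiff, hφ]
  constructor <;> intros <;> simp only [key, map_add, map_smul, hf.add_left, hf.smul_left,
    hf.add_right, hf.smul_right] <;> rfl

theorem zero_left (hf : RankOneAffine f) (v : Fin n → K) : rankOneDiff 0 v f = 0 := by
  simpa using hf.smul_left 0 0 v

theorem zero_right (hf : RankOneAffine f) (v : Fin n → K) : rankOneDiff v 0 f = 0 := by
  simpa using hf.smul_right 0 v 0

/-- The increment along `u vᵀ` does not change along `u' vᵀ`: for fixed `v`, the function `f` is
affine on the translates of the space of all `u vᵀ`. -/
theorem diff_left (hf : RankOneAffine f) (u u' v : Fin n → K) :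
    rankOneDiff u' v (rankOneDiff u v f) = 0 := by
  ext X
  have h := congrFun (hf.add_left u' u v) X
  simp only [rankOneDiff, Pi.add_apply, Pi.zero_apply, add_vecMulVec, ← add_assoc] at h ⊢
  linear_combination h

theorem diff_right (hf : RankOneAffine f) (u v v' : Fin n → K) :
    rankOneDiff u v' (rankOneDiff u v f) = 0 := by
  ext X
  have h := congrFun (hf.add_right u v' v) X
  simp only [rankOneDiff, Pi.add_apply, Pi.zero_apply, vecMulVec_add, ← add_assoc] at h ⊢
  linear_combination h

theorem diff (hf : RankOneAffine f) (u v : Fin n → K) : RankOneAffine (rankOneDiff u v f) where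
  add_left a a' b := by
    simp only [rankOneDiff_comm _ _ u v, hf.add_left, rankOneDiff_add]
  smul_left c a b := by
    simp only [rankOneDiff_comm _ _ u v, hf.smul_left, rankOneDiff_smul]
  add_right a a' b := by
    simp only [rankOneDiff_comm _ _ u v, hf.add_right, rankOneDiff_add]
  smul_right c a b := by
    simp only [rankOneDiff_comm _ _ u v, hf.smul_right, rankOneDiff_smul]

/-- Second increments are alternating in the left vectors, hence, since increments commute, also in
the right vectors. By additivity in `v` at every base point, increments along `w vᵀ` and `w v'ᵀ`
compose to zero; the identity is the polarization in `w`. -/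
theorem diff_swap (hf : RankOneAffine f) (u v u' v' : Fin n → K) :
    rankOneDiff u v (rankOneDiff u' v' f) = -rankOneDiff u' v (rankOneDiff u v' f) := by
  have h := hf.diff_right (u + u') v' v
  rw [hf.add_left, rankOneDiff_add, (hf.diff u v').add_left, (hf.diff u' v').add_left,
    hf.diff_right, hf.diff_right] at h
  rw [eq_neg_iff_add_eq_zero, ← h]
  ring

end RankOneAffine

/-- Iterated increments along a list of rank-one matrices `u vᵀ`, each encoded by the pair
`(u, v)`. -/
def iterDiff (L : List ((Fin n → K) × (Fin n → K))) (f : Matrix (Fin n) (Fin n) K → K) :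
    Matrix (Fin n) (Fin n) K → K :=
  L.foldr (fun p g => rankOneDiff p.1 p.2 g) f

@[simp] theorem iterDiff_nil (f : Matrix (Fin n) (Fin n) K → K) : iterDiff [] f = f := rfl

@[simp] theorem iterDiff_cons (p : (Fin n → K) × (Fin n → K)) (L)
    (f : Matrix (Fin n) (Fin n) K → K) :
    iterDiff (p :: L) f = rankOneDiff p.1 p.2 (iterDiff L f) := rfl

theorem iterDiff_perm {L L' : List ((Fin n → K) × (Fin n → K))} (h : L.Perm L')
    (f : Matrix (Fin n) (Fin n) K → K) : iterDiff L f = iterDiff L' f := by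
  induction h with
  | nil => rfl
  | cons p _ ih => simp [ih]
  | swap p p' L => simp [rankOneDiff_comm p.1 p.2]
  | trans _ _ ih ih' => exact ih.trans ih'

theorem iterDiff_zero (L : List ((Fin n → K) × (Fin n → K))) :
    iterDiff L (0 : Matrix (Fin n) (Fin n) K → K) = 0 := by
  induction L with
  | nil => rfl
  | cons p L ih => simp [ih, rankOneDiff_zero]

namespace RankOneAffine

theorem iterate (hf : RankOneAffine f) (L) : RankOneAffine (iterDiff L f) := by
  induction L with
  | nil => exact hf
  | cons p L ih => exact ih.diff _ _

/-- An iterated increment is unchanged along `w yᵀ` when `w` is the left vector of one of its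
pairs. -/
theorem iterDiff_inv_left (hf : RankOneAffine f) {L : List ((Fin n → K) × (Fin n → K))}
    {p : (Fin n → K) × (Fin n → K)} (hp : p ∈ L) (y : Fin n → K) :
    rankOneDiff p.1 y (iterDiff L f) = 0 := by
  induction L with
  | nil => simp at hp
  | cons p' L ih =>
    rw [iterDiff_cons]
    rcases List.mem_cons.1 hp with rfl | hp
    · exact (hf.iterate L).diff_right _ _ _
    · rw [rankOneDiff_comm, ih hp, rankOneDiff_zero]

theorem iterDiff_inv_right (hf : RankOneAffine f) {L : List ((Fin n → K) × (Fin n → K))}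
    {p : (Fin n → K) × (Fin n → K)} (hp : p ∈ L) (y : Fin n → K) :
    rankOneDiff y p.2 (iterDiff L f) = 0 := by
  induction L with
  | nil => simp at hp
  | cons p' L ih =>
    rw [iterDiff_cons]
    rcases List.mem_cons.1 hp with rfl | hp
    · exact (hf.iterate L).diff_left _ _ _
    · rw [rankOneDiff_comm, ih hp, rankOneDiff_zero]

/-- The increments of `f` along all the `w yᵀ`, `y` arbitrary, vanish for `w` in a subspace. -/
theorem diff_eq_zero_of_mem_span (hf : RankOneAffine f) {S : Set (Fin n → K)}
    (h : ∀ w ∈ S, ∀ y, rankOneDiff w y f = 0) {w : Fin n → K} (hw : w ∈ Submodule.span K S)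
    (y : Fin n → K) : rankOneDiff w y f = 0 := by
  induction hw using Submodule.span_induction with
  | mem x hx => exact h x hx y
  | zero => exact hf.zero_left y
  | add a b _ _ ha hb => rw [hf.add_left, ha, hb, add_zero]
  | smul c a _ ha => rw [hf.smul_left, ha, smul_zero]

end RankOneAffine

/-- If `g` is unchanged along `e_i yᵀ` for `i ∈ S`, it depends only on the rows outside `S`. -/
theorem apply_eq_of_rows_eq (S : Finset (Fin n))
    (hS : ∀ i ∈ S, ∀ y, rankOneDiff (Pi.single i 1) y g = 0)
    {X Y : Matrix (Fin n) (Fin n) K} (hXY : ∀ i ∉ S, X i = Y i) : g X = g Y := by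
  induction S using Finset.induction_on generalizing X with
  | empty => congr 1; ext i j; rw [hXY i (by simp)]
  | insert a S ha ih =>
    have h0 := congrFun (hS a (by simp) (Y a - X a)) X
    simp only [rankOneDiff, Pi.zero_apply, sub_eq_zero] at h0
    rw [← h0]
    refine ih (fun i hi => hS i (Finset.mem_insert_of_mem hi)) fun i hi => ?_
    by_cases hia : i = a
    · subst hia
      ext j; simp [vecMulVec_apply]
    · ext j
      simp [vecMulVec_apply, hia, hXY i (by simp [hia, hi])]

theorem apply_eq_of_cols_eq (S : Finset (Fin n))
    (hS : ∀ i ∈ S, ∀ y, rankOneDiff y (Pi.single i 1) g = 0)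
    {X Y : Matrix (Fin n) (Fin n) K} (hXY : ∀ i ∉ S, ∀ j, X j i = Y j i) : g X = g Y := by
  induction S using Finset.induction_on generalizing X with
  | empty => congr 1; ext i j; rw [hXY j (by simp)]
  | insert a S ha ih =>
    have h0 := congrFun (hS a (by simp) (fun j => Y j a - X j a)) X
    simp only [rankOneDiff, Pi.zero_apply, sub_eq_zero] at h0
    rw [← h0]
    refine ih (fun i hi => hS i (Finset.mem_insert_of_mem hi)) fun i hi j => ?_
    by_cases hia : i = a
    · subst hia
      simp [vecMulVec_apply]
    · simp [vecMulVec_apply, hia, hXY i (by simp [hia, hi])]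

theorem apply_eq_of_entries_eq (S T : Finset (Fin n))
    (hS : ∀ i ∈ S, ∀ y, rankOneDiff (Pi.single i 1) y g = 0)
    (hT : ∀ i ∈ T, ∀ y, rankOneDiff y (Pi.single i 1) g = 0)
    {X Y : Matrix (Fin n) (Fin n) K} (hXY : ∀ i ∉ S, ∀ j ∉ T, X i j = Y i j) : g X = g Y := by
  let Z : Matrix (Fin n) (Fin n) K := Matrix.of fun i => if i ∈ S then Y i else X i
  have h1 : g X = g Z := apply_eq_of_rows_eq S hS fun i hi => by ext j; simp [Z, hi]
  have h2 : g Z = g Y := apply_eq_of_cols_eq T hT fun j hj i => by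
    by_cases hi : i ∈ S
    · simp [Z, hi]
    · simp [Z, hi, hXY i hi j hj]
  rw [h1, h2]

theorem diff_eq_zero_of_rows (S : Finset (Fin n))
    (hS : ∀ i ∈ S, ∀ y, rankOneDiff (Pi.single i 1) y g = 0) {w : Fin n → K}
    (hw : ∀ i ∉ S, w i = 0) (y : Fin n → K) : rankOneDiff w y g = 0 := by
  ext X
  rw [rankOneDiff, Pi.zero_apply, sub_eq_zero]
  refine apply_eq_of_rows_eq S hS fun i hi => ?_
  ext j; simp [vecMulVec_apply, hw i hi]

theorem diff_eq_zero_of_cols (S : Finset (Fin n))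
    (hS : ∀ i ∈ S, ∀ y, rankOneDiff y (Pi.single i 1) g = 0) {w : Fin n → K}
    (hw : ∀ i ∉ S, w i = 0) (y : Fin n → K) : rankOneDiff y w g = 0 := by
  ext X
  rw [rankOneDiff, Pi.zero_apply, sub_eq_zero]
  refine apply_eq_of_cols_eq S hS fun i hi j => ?_
  simp [vecMulVec_apply, hw i hi]

/-- A function all of whose coordinate increments vanish is constant. -/
theorem RankOneAffine.eq_const (hg : RankOneAffine g)
    (h : ∀ i j : Fin n, rankOneDiff (Pi.single i 1) (Pi.single j 1) g = 0)
    (X Y : Matrix (Fin n) (Fin n) K) : g X = g Y := by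
  refine apply_eq_of_rows_eq Finset.univ (fun i _ y => ?_) (by simp)
  have hy : y = ∑ j, y j • (Pi.single j 1 : Fin n → K) := by
    ext k; simp [Finset.sum_apply, Pi.single_apply]
  rw [hy]
  induction (Finset.univ : Finset (Fin n)) using Finset.induction_on with
  | empty => simp [hg.zero_right]
  | insert a S ha ih => rw [Finset.sum_insert ha, hg.add_right, ih, hg.smul_right, h]; simp

end

/-! ### Hermitian matrices and their zeros -/

/-- Hermitian matrices for the conjugation `σ`. -/
def IsHerm {K : Type*} [Field K] (σ : K →+* K) {n : ℕ} (X : Matrix (Fin n) (Fin n) K) : Prop :=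
  ∀ i j, σ (X j i) = X i j

/-- Rank-one affine functions compatible with the conjugation. They take values in the fixed field
of `σ` on Hermitian matrices. -/
structure HermFun {K : Type*} [Field K] (σ : K →+* K) {n : ℕ}
    (f : Matrix (Fin n) (Fin n) K → K) : Prop where
  affine : RankOneAffine f
  symm : ∀ X, f (Xᵀ.map σ) = σ (f X)

section

variable {K : Type*} [Field K] {n : ℕ} {f : Matrix (Fin n) (Fin n) K → K} {σ : K →+* K}

theorem IsHerm.map_eq {X : Matrix (Fin n) (Fin n) K} (hX : IsHerm σ X) : Xᵀ.map σ = X := by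
  ext i j; exact hX i j

theorem isHerm_zero : IsHerm σ (0 : Matrix (Fin n) (Fin n) K) := fun i j => by simp

theorem HermFun.fixed (hf : HermFun σ f) {X : Matrix (Fin n) (Fin n) K} (hX : IsHerm σ X) :
    σ (f X) = f X := by
  rw [← hf.symm, hX.map_eq]

theorem comp_single (i : Fin n) : σ ∘ (Pi.single i 1 : Fin n → K) = Pi.single i 1 := by
  ext j
  simp only [Function.comp_apply, Pi.single_apply]
  split_ifs <;> simp

variable [Fintype K] {q : ℕ}

theorem QuadConj.comp_comp (h : QuadConj q σ) (w : Fin n → K) : σ ∘ (σ ∘ w) = w := by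
  ext i; exact h.invol _

/-- Polarization: over a field with conjugation the increments along `w w*` determine all
increments along `u vᵀ`. -/
theorem RankOneAffine.polarize (h : QuadConj q σ) (hf : RankOneAffine f)
    {X : Matrix (Fin n) (Fin n) K} (hX : ∀ w, rankOneDiff w (σ ∘ w) f X = 0) (u v : Fin n → K) :
    rankOneDiff u v f X = 0 := by
  refine (h.eq_zero_of_linear (α := rankOneDiff u v f X)
    (β := rankOneDiff (σ ∘ v) (σ ∘ u) f X) fun t => ?_).1
  have e : σ ∘ (u + t • (σ ∘ v)) = σ ∘ u + σ t • v := by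
    ext i; simp [h.invol]
  have h1 := hX (u + t • (σ ∘ v))
  have h2 := hX u
  have h3 := hX (σ ∘ v)
  rw [h.comp_comp] at h3
  rw [e] at h1
  simp only [hf.add_left, hf.add_right, hf.smul_left, hf.smul_right, Pi.add_apply, Pi.smul_apply,
    smul_eq_mul, h2, h3] at h1
  linear_combination h1

/-- A function is constant as soon as its increments along all `w w*` vanish. -/
theorem RankOneAffine.eq_const_of_herm (h : QuadConj q σ) (hf : RankOneAffine f)
    (hX : ∀ w, rankOneDiff w (σ ∘ w) f = 0) (X Y : Matrix (Fin n) (Fin n) K) : f X = f Y :=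
  hf.eq_const (fun i j => by
    ext Z
    exact hf.polarize h (fun w => congrFun (hX w) Z) _ _) X Y

theorem HermFun.diff_symm (h : QuadConj q σ) (hf : HermFun σ f) (u v : Fin n → K)
    (X : Matrix (Fin n) (Fin n) K) :
    rankOneDiff u v f (Xᵀ.map σ) = σ (rankOneDiff (σ ∘ v) (σ ∘ u) f X) := by
  have e : Xᵀ.map σ + vecMulVec u v = (X + vecMulVec (σ ∘ v) (σ ∘ u))ᵀ.map σ := by
    ext i j; simp [vecMulVec_apply, h.invol]
  simp only [rankOneDiff]
  rw [e, hf.symm, hf.symm, map_sub]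

theorem HermFun.diff (h : QuadConj q σ) (hf : HermFun σ f) (w : Fin n → K) :
    HermFun σ (rankOneDiff w (σ ∘ w) f) :=
  ⟨hf.affine.diff _ _, fun X => by rw [hf.diff_symm h, h.comp_comp]⟩

theorem HermFun.iterate (h : QuadConj q σ) (hf : HermFun σ f)
    (L : List ((Fin n → K) × (Fin n → K))) (hL : ∀ p ∈ L, p.2 = σ ∘ p.1) :
    HermFun σ (iterDiff L f) := by
  induction L with
  | nil => exact hf
  | cons p L ih =>
    rw [iterDiff_cons, hL p (by simp)]
    exact (ih fun p hp => hL p (by simp [hp])).diff h _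

end

/-- The matrix with corner `a`, first column `v` below it, first row `v*`, and remaining block
`M`. -/
def bordered {K : Type*} [Field K] (σ : K →+* K) {n : ℕ} (a : K) (v : Fin n → K)
    (M : Matrix (Fin n) (Fin n) K) : Matrix (Fin (n + 1)) (Fin (n + 1)) K :=
  Matrix.of (Fin.cons (Fin.cons a (σ ∘ v)) fun i => Fin.cons (v i) (M i))

/-- Extend both vectors of a pair by a zero in front. -/
def liftPair {K : Type*} [Field K] {n : ℕ} (p : (Fin n → K) × (Fin n → K)) :
    (Fin (n + 1) → K) × (Fin (n + 1) → K) :=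
  (Fin.cons 0 p.1, Fin.cons 0 p.2)

/-- The pair of coordinate vectors `(e_i, e_j)`. -/
def unitPair (K : Type*) [Field K] {n : ℕ} (i j : Fin n) : (Fin n → K) × (Fin n → K) :=
  (Pi.single i 1, Pi.single j 1)

section

variable {K : Type*} [Field K] {n : ℕ} {σ : K →+* K}

@[simp] theorem bordered_zero_zero (a : K) (v : Fin n → K) (M : Matrix (Fin n) (Fin n) K) :
    bordered σ a v M 0 0 = a := rfl
@[simp] theorem bordered_zero_succ (a : K) (v : Fin n → K) (M : Matrix (Fin n) (Fin n) K) (j) :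
    bordered σ a v M 0 (Fin.succ j) = σ (v j) := rfl
@[simp] theorem bordered_succ_zero (a : K) (v : Fin n → K) (M : Matrix (Fin n) (Fin n) K) (i) :
    bordered σ a v M (Fin.succ i) 0 = v i := rfl
@[simp] theorem bordered_succ_succ (a : K) (v : Fin n → K) (M : Matrix (Fin n) (Fin n) K) (i j) :
    bordered σ a v M (Fin.succ i) (Fin.succ j) = M i j := rfl

theorem isHerm_bordered [Fintype K] {q : ℕ} (h : QuadConj q σ) {a : K} {v : Fin n → K}
    {M : Matrix (Fin n) (Fin n) K} : IsHerm σ (bordered σ a v M) ↔ σ a = a ∧ IsHerm σ M := by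
  constructor
  · exact fun H => ⟨H 0 0, fun i j => H i.succ j.succ⟩
  · rintro ⟨ha, hM⟩ i j
    refine Fin.cases ?_ (fun i => ?_) i <;> refine Fin.cases ?_ (fun j => ?_) j
    · simpa
    · simp
    · simp [h.invol]
    · simpa using hM i j

theorem bordered_add_vecMulVec (a : K) (v : Fin n → K) (M : Matrix (Fin n) (Fin n) K)
    (u w : Fin n → K) : bordered σ a v (M + vecMulVec u w) =
      bordered σ a v M + vecMulVec (Fin.cons 0 u) (Fin.cons 0 w) := by
  ext i j
  refine Fin.cases ?_ (fun i => ?_) i <;> refine Fin.cases ?_ (fun j => ?_) j <;>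
    simp [vecMulVec_apply]

theorem bordered_map [Fintype K] {q : ℕ} (h : QuadConj q σ) {a : K} (ha : σ a = a) (v : Fin n → K)
    (M : Matrix (Fin n) (Fin n) K) : bordered σ a v (Mᵀ.map σ) = (bordered σ a v M)ᵀ.map σ := by
  ext i j
  refine Fin.cases ?_ (fun i => ?_) i <;> refine Fin.cases ?_ (fun j => ?_) j <;>
    simp [ha, h.invol]

theorem RankOneAffine.comp_bordered {f : Matrix (Fin (n + 1)) (Fin (n + 1)) K → K}
    (hf : RankOneAffine f) (a : K) (v : Fin n → K) : RankOneAffine (f ∘ bordered σ a v) := by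
  let A : (Fin n → K) →ₗ[K] (Fin (n + 1) → K) :=
    { toFun := fun u => Fin.cons 0 u
      map_add' := fun u w => by
        ext i; refine Fin.cases ?_ (fun i => ?_) i <;> simp
      map_smul' := fun c u => by
        ext i; refine Fin.cases ?_ (fun i => ?_) i <;> simp }
  exact hf.comp _ A A fun X u w => bordered_add_vecMulVec a v X u w

theorem HermFun.comp_bordered [Fintype K] {q : ℕ} (h : QuadConj q σ)
    {f : Matrix (Fin (n + 1)) (Fin (n + 1)) K → K}
    (hf : HermFun σ f) {a : K} (ha : σ a = a) (v : Fin n → K) : HermFun σ (f ∘ bordered σ a v) :=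
  ⟨hf.affine.comp_bordered a v, fun X => by
    simp only [Function.comp_apply, bordered_map h ha, hf.symm]⟩

theorem iterDiff_bordered (L : List ((Fin n → K) × (Fin n → K)))
    (f : Matrix (Fin (n + 1)) (Fin (n + 1)) K → K) (a : K) (v : Fin n → K) :
    iterDiff L (f ∘ bordered σ a v) = iterDiff (L.map liftPair) f ∘ bordered σ a v := by
  induction L with
  | nil => rfl
  | cons p L ih =>
    ext X
    simp only [iterDiff_cons, List.map_cons, ih, rankOneDiff, Function.comp_apply,
      bordered_add_vecMulVec]
    rfl

theorem liftPair_unitPair (i j : Fin n) :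
    liftPair (unitPair K i j) = unitPair K i.succ j.succ := by
  simp only [liftPair, unitPair, Prod.mk.injEq]
  constructor <;> (ext k; refine Fin.cases ?_ (fun k => ?_) k <;> simp [Pi.single_apply])

end

section

variable {K : Type*} [Field K] {n : ℕ} {σ : K →+* K}

/-- The congruence `X ↦ P X P*`. -/
def congruence (σ : K →+* K) (P X : Matrix (Fin n) (Fin n) K) : Matrix (Fin n) (Fin n) K :=
  P * X * Pᵀ.map σ

theorem congruence_add_vecMulVec (P X : Matrix (Fin n) (Fin n) K) (u v : Fin n → K) :
    congruence σ P (X + vecMulVec u v) =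
      congruence σ P X + vecMulVec (P *ᵥ u) ((P.map σ) *ᵥ v) := by
  simp only [congruence, Matrix.mul_add, Matrix.add_mul, Matrix.mul_vecMulVec,
    Matrix.vecMulVec_mul]
  congr 2
  rw [← Matrix.vecMul_transpose, ← Matrix.transpose_map]

theorem congruence_congruence (P R X : Matrix (Fin n) (Fin n) K) :
    congruence σ P (congruence σ R X) = congruence σ (P * R) X := by
  simp only [congruence, Matrix.transpose_mul, Matrix.map_mul, Matrix.mul_assoc]

theorem congruence_one (X : Matrix (Fin n) (Fin n) K) : congruence σ 1 X = X := by
  simp [congruence]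

theorem iterDiff_congruence (L : List ((Fin n → K) × (Fin n → K)))
    (f : Matrix (Fin n) (Fin n) K → K) (P : Matrix (Fin n) (Fin n) K) :
    iterDiff L (f ∘ congruence σ P) =
      iterDiff (L.map fun p => (P *ᵥ p.1, (P.map σ) *ᵥ p.2)) f ∘ congruence σ P := by
  induction L with
  | nil => rfl
  | cons p L ih =>
    ext X
    simp only [iterDiff_cons, List.map_cons, ih, rankOneDiff, Function.comp_apply,
      congruence_add_vecMulVec]

end

/-- The number of zeros of `f` among the Hermitian matrices. -/
noncomputable def hermZeros {K : Type*} [Field K] (σ : K →+* K) {n : ℕ}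
    (f : Matrix (Fin n) (Fin n) K → K) : ℕ :=
  Nat.card {X : Matrix (Fin n) (Fin n) K // IsHerm σ X ∧ f X = 0}

section

variable {K : Type*} [Field K] [Fintype K] {n : ℕ} {σ : K →+* K} {q : ℕ}

theorem hermZeros_mono {m n : ℕ} {f : Matrix (Fin n) (Fin n) K → K}
    {g : Matrix (Fin m) (Fin m) K → K}
    (φ : Matrix (Fin n) (Fin n) K → Matrix (Fin m) (Fin m) K) (hφ : Function.Injective φ)
    (h : ∀ X, IsHerm σ X → f X = 0 → IsHerm σ (φ X) ∧ g (φ X) = 0) :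
    hermZeros σ f ≤ hermZeros σ g := by
  refine Nat.card_le_card_of_injective
    (fun X => (⟨φ X.1, h X.1 X.2.1 X.2.2⟩ : {X // IsHerm σ X ∧ g X = 0})) ?_
  intro X Y hXY
  exact Subtype.ext (hφ (congrArg Subtype.val hXY))

/-- Removing the first row and column splits the Hermitian zeros of `f`. -/
theorem hermZeros_eq_sum [DecidableEq K] (h : QuadConj q σ)
    (f : Matrix (Fin (n + 1)) (Fin (n + 1)) K → K) :
    hermZeros σ f = ∑ a : FixedBy σ, ∑ v : Fin n → K, hermZeros σ (f ∘ bordered σ a.1 v) := by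
  let e : {X : Matrix (Fin (n + 1)) (Fin (n + 1)) K // IsHerm σ X ∧ f X = 0} ≃
      (Σ a : FixedBy σ, Σ v : Fin n → K,
        {M : Matrix (Fin n) (Fin n) K // IsHerm σ M ∧ (f ∘ bordered σ a.1 v) M = 0}) :=
    { toFun := fun X =>
        have e : bordered σ (X.1 0 0) (fun i => X.1 i.succ 0)
            (X.1.submatrix Fin.succ Fin.succ) = X.1 := by
          ext i j
          refine Fin.cases ?_ (fun i => ?_) i <;> refine Fin.cases ?_ (fun j => ?_) j
          · simp
          · simp [X.2.1 0 j.succ]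
          · simp
          · simp
        ⟨⟨X.1 0 0, X.2.1 0 0⟩, fun i => X.1 i.succ 0, X.1.submatrix Fin.succ Fin.succ,
          fun i j => X.2.1 i.succ j.succ, by
            simp only [Function.comp_apply]
            rw [e]; exact X.2.2⟩
      invFun := fun x => ⟨bordered σ x.1.1 x.2.1 x.2.2.1,
        (isHerm_bordered h).2 ⟨x.1.2, x.2.2.2.1⟩, x.2.2.2.2⟩
      left_inv := by
        rintro ⟨X, hX, h0⟩
        ext i j
        refine Fin.cases ?_ (fun i => ?_) i <;> refine Fin.cases ?_ (fun j => ?_) j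
        · simp
        · simp [hX 0 j.succ]
        · simp
        · simp
      right_inv := by
        rintro ⟨⟨a, ha⟩, v, M, hM⟩
        rfl }
  rw [hermZeros, Nat.card_congr e]
  simp only [Nat.card_sigma, hermZeros]

/-- The zero function has as many Hermitian zeros as there are Hermitian matrices. -/
theorem hermZeros_zero [DecidableEq K] (h : QuadConj q σ) (n : ℕ) :
    hermZeros σ (0 : Matrix (Fin n) (Fin n) K → K) = q ^ n ^ 2 := by
  induction n with
  | zero =>
    rw [hermZeros, Nat.card_eq_one_iff_unique.2]
    · simp
    · exact ⟨⟨fun X Y => Subtype.ext (Subsingleton.elim _ _)⟩, ⟨0, isHerm_zero, rfl⟩⟩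
  | succ n ih =>
    rw [hermZeros_eq_sum h]
    have : ∀ a v, hermZeros σ ((0 : Matrix (Fin (n + 1)) (Fin (n + 1)) K → K) ∘ bordered σ a v)
      = q ^ n ^ 2 := fun a v => ih
    simp only [this, Finset.sum_const, Finset.card_univ, h.card_fixed, smul_eq_mul,
      Fintype.card_fun, h.card, Fintype.card_fin]
    ring

theorem hermZeros_le [DecidableEq K] (h : QuadConj q σ) (f : Matrix (Fin n) (Fin n) K → K) :
    hermZeros σ f ≤ q ^ n ^ 2 := by
  rw [← hermZeros_zero h]
  exact hermZeros_mono id Function.injective_id fun X hX _ => ⟨hX, rfl⟩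

theorem congruence_map (h : QuadConj q σ) (P X : Matrix (Fin n) (Fin n) K) :
    congruence σ P (Xᵀ.map σ) = (congruence σ P X)ᵀ.map σ := by
  have e : (P.map σ).map σ = P := by ext i j; simp [h.invol]
  simp only [congruence, Matrix.transpose_mul, Matrix.map_mul, Matrix.mul_assoc,
    Matrix.transpose_map, Matrix.transpose_transpose, e]

theorem HermFun.comp_congruence (h : QuadConj q σ) {f : Matrix (Fin n) (Fin n) K → K}
    (hf : HermFun σ f) (P : Matrix (Fin n) (Fin n) K) : HermFun σ (f ∘ congruence σ P) :=
  ⟨hf.affine.comp _ P.mulVecLin (P.map σ).mulVecLin fun X u v => by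
      simp [congruence_add_vecMulVec],
    fun X => by simp only [Function.comp_apply, congruence_map h, hf.symm]⟩

theorem IsHerm.congruence (h : QuadConj q σ) {X : Matrix (Fin n) (Fin n) K} (hX : IsHerm σ X)
    (P : Matrix (Fin n) (Fin n) K) : IsHerm σ (congruence σ P X) := by
  have := congruence_map h P X
  rw [hX.map_eq] at this
  intro i j
  exact (congrFun (congrFun this i) j).symm

theorem hermZeros_comp_congruence (h : QuadConj q σ) (f : Matrix (Fin n) (Fin n) K → K)
    {P : Matrix (Fin n) (Fin n) K} (hP : IsUnit P) :
    hermZeros σ (f ∘ congruence σ P) = hermZeros σ f := by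
  obtain ⟨R, hPR, hRP⟩ := isUnit_iff_exists.1 hP
  have inj : ∀ {P R : Matrix (Fin n) (Fin n) K}, R * P = 1 →
      Function.Injective (congruence σ P) := by
    intro P R hRP X Y hXY
    have := congrArg (congruence σ R) hXY
    simpa [congruence_congruence, hRP, congruence_one] using this
  apply le_antisymm
  · exact hermZeros_mono (congruence σ P) (inj hRP) fun X hX h0 => ⟨hX.congruence h P, h0⟩
  · refine hermZeros_mono (congruence σ R) (inj hPR) fun X hX h0 => ⟨hX.congruence h R, ?_⟩
    simp [congruence_congruence, hPR, congruence_one, h0]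


end

/-! ### The coefficient of the determinant, and the dichotomy -/

section

variable {K : Type*} [Field K] {n : ℕ} {σ : K →+* K}

/-- The increment of `f` along all the diagonal matrix units: the coefficient of the determinant
in `f`. -/
def topDiff (f : Matrix (Fin n) (Fin n) K → K) : Matrix (Fin n) (Fin n) K → K :=
  iterDiff ((List.finRange n).map fun i => unitPair K i i) f

/-- The pair `(w, w̄)`, whose rank-one matrix is `w w*`. -/
def hermPair (σ : K →+* K) (w : Fin n → K) : (Fin n → K) × (Fin n → K) := (w, σ ∘ w)

/-- Nonzero iterated increments along `w w*` use linearly independent vectors `w`. -/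
theorem RankOneAffine.length_le_finrank {f : Matrix (Fin n) (Fin n) K → K} (hf : RankOneAffine f)
    (L : List (Fin n → K)) (hL : iterDiff (L.map (hermPair σ)) f ≠ 0) :
    L.length ≤ Module.finrank K (Submodule.span K {w | w ∈ L}) := by
  induction L with
  | nil => simp
  | cons w L ih =>
    rw [List.map_cons, iterDiff_cons] at hL
    have h1 : iterDiff (L.map (hermPair σ)) f ≠ 0 := by
      intro h0; rw [h0, rankOneDiff_zero] at hL; exact hL rfl
    have hw : w ∉ Submodule.span K {w | w ∈ L} := by
      intro hw
      refine hL ((hf.iterate _).diff_eq_zero_of_mem_span (fun w' hw' y => ?_) hw _)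
      exact hf.iterDiff_inv_left (p := hermPair σ w') (List.mem_map_of_mem hw') y
    have hlt : Submodule.span K {w | w ∈ L} < Submodule.span K {w' | w' ∈ w :: L} := by
      refine lt_of_le_of_ne (Submodule.span_mono fun x hx => List.mem_cons_of_mem _ hx) ?_
      intro heq
      exact hw (heq ▸ Submodule.subset_span (List.mem_cons_self))
    have := Submodule.finrank_lt_finrank_of_lt hlt
    simp only [List.length_cons]
    have := ih h1
    omega

/-- A nonzero vector is the first row of an invertible matrix. -/
theorem exists_isUnit_row_zero (φ : Fin (n + 1) → K) (hφ : φ ≠ 0) :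
    ∃ R : Matrix (Fin (n + 1)) (Fin (n + 1)) K, IsUnit R ∧ R 0 = φ := by
  obtain ⟨j, hj⟩ := Function.ne_iff.1 hφ
  refine ⟨Matrix.of (Fin.cons φ fun i => Pi.single (j.succAbove i) 1), ?_, rfl⟩
  rw [← Matrix.mulVec_injective_iff_isUnit]
  rw [← Matrix.coe_mulVecLin, ← LinearMap.ker_eq_bot, LinearMap.ker_eq_bot']
  intro x hx
  have h1 : ∀ i, x (j.succAbove i) = 0 := by
    intro i
    have := congrFun hx i.succ
    simpa [Matrix.mulVec, dotProduct, Pi.single_apply] using this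
  have h2 : φ j * x j = 0 := by
    have := congrFun hx 0
    simp only [Matrix.mulVecLin_apply, Matrix.mulVec, dotProduct, Matrix.of_apply, Fin.cons_zero,
      Pi.zero_apply] at this
    rw [Fin.sum_univ_succAbove _ j] at this
    simpa [h1] using this
  have h3 : x j = 0 := (mul_eq_zero.1 h2).resolve_left hj
  ext i
  rcases Fin.eq_self_or_eq_succAbove j i with rfl | ⟨k, rfl⟩
  · exact h3
  · exact h1 k

/-- Some nonzero iterated increment along matrices `w w*` has no nonzero further increment of this
kind, since the lists of vectors in question have length at most `n`. -/
theorem HermFun.exists_maximal {f : Matrix (Fin n) (Fin n) K → K}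
    (hf : HermFun σ f) (h0 : f ≠ 0) : ∃ L : List (Fin n → K),
      iterDiff (L.map (hermPair σ)) f ≠ 0 ∧
        ∀ w, rankOneDiff w (σ ∘ w) (iterDiff (L.map (hermPair σ)) f) = 0 := by
  by_contra hcon
  push Not at hcon
  have key : ∀ k : ℕ, ∃ L : List (Fin n → K), L.length = k ∧
      iterDiff (L.map (hermPair σ)) f ≠ 0 := by
    intro k
    induction k with
    | zero => exact ⟨[], rfl, h0⟩
    | succ k ih =>
      obtain ⟨L, hL, hne⟩ := ih
      obtain ⟨w, hw⟩ := hcon L hne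
      exact ⟨w :: L, by simp [hL], hw⟩
  obtain ⟨L, hL, hne⟩ := key (n + 1)
  have h1 := hf.affine.length_le_finrank L hne
  have h2 := Submodule.finrank_le (Submodule.span K {w | w ∈ L})
  simp at h2
  omega

variable [Fintype K] {q : ℕ}

/-- Up to a congruence, either the determinant has a nonzero coefficient in `f`, or no restriction
of `f` to matrices with prescribed first row and column vanishes. -/
theorem HermFun.dichotomy (h : QuadConj q σ) {f : Matrix (Fin (n + 1)) (Fin (n + 1)) K → K}
    (hf : HermFun σ f) (h0 : f ≠ 0) : ∃ P : Matrix (Fin (n + 1)) (Fin (n + 1)) K, IsUnit P ∧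
      (topDiff (f ∘ congruence σ P) ≠ 0 ∨
        ∀ a v, (f ∘ congruence σ P) ∘ bordered σ a v ≠ 0) := by
  obtain ⟨L, hL, hmax⟩ := hf.exists_maximal h0
  set g := iterDiff (L.map (hermPair σ)) f with hg
  have hconst := (hf.affine.iterate (L.map (hermPair σ))).eq_const_of_herm h hmax
  rw [← hg] at hconst
  have hgne : ∀ X, g X ≠ 0 := by
    intro X hX
    apply hL
    ext Y
    rw [hconst Y X, hX]; rfl
  have hmap : ∀ (P : Matrix (Fin (n + 1)) (Fin (n + 1)) K) (u : Fin (n + 1) → K),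
      (P.map σ) *ᵥ (σ ∘ u) = σ ∘ (P *ᵥ u) := by
    intro P u; ext i; simp [RingHom.map_mulVec, Function.comp_def]
  -- the vectors of a maximal list are independent; the two cases are whether they span the space
  by_cases hspan : Submodule.span K {w | w ∈ L} = ⊤
  · -- a congruence takes the list to the coordinate vectors
    have hlen : L.length = n + 1 := by
      apply le_antisymm
      · have h1 := hf.affine.length_le_finrank L hL
        have h2 := Submodule.finrank_le (Submodule.span K {w | w ∈ L})
        simp at h2
        omega
      · classical
        have h1 := finrank_span_finset_le_card (R := K) L.toFinset
        rw [show ((L.toFinset : Finset (Fin (n + 1) → K)) : Set (Fin (n + 1) → K)) = {w | w ∈ L} by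
          ext; simp, Set.finrank, hspan] at h1
        simp at h1
        have := L.toFinset_card_le
        omega
    obtain ⟨w, rfl⟩ : ∃ w : Fin (n + 1) → (Fin (n + 1) → K), L = List.ofFn w :=
      ⟨fun i => L.get (i.cast hlen.symm), by
        refine List.ext_get (by simp [hlen]) fun i h1 h2 => ?_
        rw [List.get_ofFn]
        rfl⟩
    refine ⟨(Matrix.of w)ᵀ, ?_, Or.inl ?_⟩
    · rw [← Matrix.mulVec_surjective_iff_isUnit, ← Matrix.coe_mulVecLin, ← LinearMap.range_eq_top,
        Matrix.range_mulVecLin, ← hspan]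
      congr 1
      ext x
      exact (List.mem_ofFn' w x).symm
    · have e : topDiff (f ∘ congruence σ (Matrix.of w)ᵀ) = g ∘ congruence σ (Matrix.of w)ᵀ := by
        rw [topDiff, iterDiff_congruence, hg, List.ofFn_eq_map, List.map_map, List.map_map]
        congr 3
        ext i : 1
        have e1 : (Matrix.of w)ᵀ *ᵥ Pi.single i 1 = w i := by
          ext k; simp
        simp only [Function.comp_apply, unitPair, hermPair, e1, Prod.mk.injEq, true_and]
        rw [← comp_single (σ := σ) i, hmap, e1]
      rw [e]
      intro hz
      exact hgne _ (congrFun hz 0)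
  · -- a congruence moves all vectors of the list into the hyperplane `x 0 = 0`, so that the maximal
    -- iterated increment only involves directions inside the lower right block
    obtain ⟨φ, hφ, hker⟩ := Submodule.exists_le_ker_of_lt_top _ (lt_top_iff_ne_top.2 hspan)
    let ψ : Fin (n + 1) → K := fun i => φ (Pi.single i 1)
    have hψ : ∀ x, ψ ⬝ᵥ x = φ x := by
      intro x
      rw [LinearMap.pi_apply_eq_sum_univ φ x]
      simp only [dotProduct, ψ, smul_eq_mul]
      refine Finset.sum_congr rfl fun i _ => ?_
      rw [mul_comm]
      congr 2
      ext k; simp [Pi.single_apply, eq_comm]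
    have hψ0 : ψ ≠ 0 := by
      intro hz
      apply hφ
      ext x
      simp [← hψ, hz]
    obtain ⟨R, hR, hR0⟩ := exists_isUnit_row_zero ψ hψ0
    obtain ⟨P, hRP, hPR⟩ := isUnit_iff_exists.1 hR
    refine ⟨P, isUnit_iff_exists.2 ⟨R, hPR, hRP⟩, Or.inr fun a v hz => ?_⟩
    let L' := L.map fun w => hermPair σ (Fin.tail (R *ᵥ w))
    have e : iterDiff (L'.map liftPair) (f ∘ congruence σ P) = g ∘ congruence σ P := by
      rw [iterDiff_congruence, hg, List.map_map, List.map_map]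
      congr 2
      refine List.map_congr_left fun w hw => ?_
      have hw0 : (R *ᵥ w) 0 = 0 := by
        have : (R *ᵥ w) 0 = ψ ⬝ᵥ w := by rw [← hR0]; rfl
        rw [this, hψ]
        exact hker (Submodule.subset_span hw)
      have hc : (Fin.cons 0 (Fin.tail (R *ᵥ w)) : Fin (n + 1) → K) = R *ᵥ w := by
        rw [← hw0]; exact Fin.cons_self_tail _
      have hc' : (Fin.cons 0 (σ ∘ Fin.tail (R *ᵥ w)) : Fin (n + 1) → K) = σ ∘ (R *ᵥ w) := by
        ext i
        refine Fin.cases ?_ (fun i => ?_) i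
        · simp [hw0]
        · simp [Fin.tail]
      simp only [Function.comp_apply, hermPair, liftPair, hc, hc', hmap, Matrix.mulVec_mulVec, hPR,
        Matrix.one_mulVec]
    have := iterDiff_bordered (σ := σ) L' (f ∘ congruence σ P) a v
    rw [hz, iterDiff_zero, e] at this
    exact hgne _ (congrFun this 0).symm

end

/-! ### Restriction to a prescribed first row and column -/

section

variable {K : Type*} [Field K] {n : ℕ} {σ : K →+* K}

theorem iterDiff_liftPair_apply_eq_zero {f : Matrix (Fin (n + 1)) (Fin (n + 1)) K → K} {a : K}
    {v : Fin n → K} (hv : f ∘ bordered σ a v = 0) (L : List ((Fin n → K) × (Fin n → K)))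
    (M : Matrix (Fin n) (Fin n) K) : iterDiff (L.map liftPair) f (bordered σ a v M) = 0 := by
  have := iterDiff_bordered (σ := σ) L f a v
  rw [hv, iterDiff_zero] at this
  exact (congrFun this M).symm

theorem topDiff_eq (f : Matrix (Fin (n + 1)) (Fin (n + 1)) K → K) :
    topDiff f = rankOneDiff (Pi.single 0 1) (Pi.single 0 1)
      (iterDiff (((List.finRange n).map fun i => unitPair K i i).map liftPair) f) := by
  rw [topDiff, List.finRange_succ, List.map_cons, iterDiff_cons, List.map_map, List.map_map]
  simp only [Function.comp_def, liftPair_unitPair]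
  rfl

theorem RankOneAffine.topDiff_const {f : Matrix (Fin n) (Fin n) K → K} (hf : RankOneAffine f)
    (X Y : Matrix (Fin n) (Fin n) K) : topDiff f X = topDiff f Y :=
  apply_eq_of_rows_eq Finset.univ
    (fun i _ y => hf.iterDiff_inv_left (p := unitPair K i i)
      (List.mem_map_of_mem (f := fun i => unitPair K i i) (List.mem_finRange i)) y) (by simp)

/-- The behaviour of `g` along the first row and column, when `g` depends on only one further row
and one further column. -/
theorem RankOneAffine.apply_add_cross {g : Matrix (Fin (n + 1)) (Fin (n + 1)) K → K}
    (hg : RankOneAffine g) (i j : Fin n)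
    (hrow : ∀ k ≠ j, ∀ y, rankOneDiff (Pi.single k.succ 1) y g = 0)
    (hcol : ∀ k ≠ i, ∀ y, rankOneDiff y (Pi.single k.succ 1) g = 0)
    (d e : Fin n → K) (X : Matrix (Fin (n + 1)) (Fin (n + 1)) K) :
    g (X + vecMulVec (Fin.cons 0 d) (Pi.single 0 1) + vecMulVec (Pi.single 0 1) (Fin.cons 0 e)) =
      g X + d j * rankOneDiff (Pi.single j.succ 1) (Pi.single 0 1) g X
        + e i * rankOneDiff (Pi.single 0 1) (Pi.single i.succ 1) g X
        + d j * e i * rankOneDiff (Pi.single j.succ 1) (Pi.single 0 1)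
          (rankOneDiff (Pi.single 0 1) (Pi.single i.succ 1) g) X := by
  have hd : ∀ g' : Matrix (Fin (n + 1)) (Fin (n + 1)) K → K, RankOneAffine g' →
      (∀ k ≠ j, ∀ y, rankOneDiff (Pi.single k.succ 1) y g' = 0) → ∀ y,
      rankOneDiff (Fin.cons 0 d) y g' = d j • rankOneDiff (Pi.single j.succ 1) y g' := by
    intro g' hg' hrow' y
    have e1 : (Fin.cons 0 d : Fin (n + 1) → K) =
        d j • Pi.single j.succ 1 + Fin.cons 0 (Function.update d j 0) := by
      ext k
      refine Fin.cases ?_ (fun k => ?_) k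
      · simp [-Fin.cons_update]
      · by_cases hk : k = j
        · subst hk; simp [-Fin.cons_update]
        · simp [hk, -Fin.cons_update]
    rw [e1, hg'.add_left, hg'.smul_left,
      diff_eq_zero_of_rows (w := Fin.cons 0 (Function.update d j 0))
        ((Finset.univ.erase j).map (Fin.succEmb n)) ?_ ?_, add_zero]
    · intro k hk
      obtain ⟨m, hm, rfl⟩ := Finset.mem_map.1 hk
      exact hrow' m (Finset.ne_of_mem_erase hm)
    · intro k
      refine Fin.cases ?_ (fun k => ?_) k
      · simp [-Fin.cons_update]
      · intro hk
        have : k = j := by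
          by_contra hne
          exact hk (Finset.mem_map_of_mem (Fin.succEmb n) (by simp [hne]))
        simp [this, -Fin.cons_update]
  have he : rankOneDiff (Pi.single 0 1) (Fin.cons 0 e) g =
      e i • rankOneDiff (Pi.single 0 1) (Pi.single i.succ 1) g := by
    have e1 : (Fin.cons 0 e : Fin (n + 1) → K) =
        e i • Pi.single i.succ 1 + Fin.cons 0 (Function.update e i 0) := by
      ext k
      refine Fin.cases ?_ (fun k => ?_) k
      · simp [-Fin.cons_update]
      · by_cases hk : k = i
        · subst hk; simp [-Fin.cons_update]
        · simp [hk, -Fin.cons_update]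
    rw [e1, hg.add_right, hg.smul_right,
      diff_eq_zero_of_cols (w := Fin.cons 0 (Function.update e i 0))
        ((Finset.univ.erase i).map (Fin.succEmb n)) ?_ ?_, add_zero]
    · intro k hk
      obtain ⟨m, hm, rfl⟩ := Finset.mem_map.1 hk
      exact hcol m (Finset.ne_of_mem_erase hm)
    · intro k
      refine Fin.cases ?_ (fun k => ?_) k
      · simp [-Fin.cons_update]
      · intro hk
        have : k = i := by
          by_contra hne
          exact hk (Finset.mem_map_of_mem (Fin.succEmb n) (by simp [hne]))
        simp [this, -Fin.cons_update]
  rw [apply_add_vecMulVec g, he, apply_add_vecMulVec g, Pi.smul_apply,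
    apply_add_vecMulVec (rankOneDiff _ _ g), hd g hg hrow, hd _ (hg.diff _ _) ?_]
  · simp only [Pi.smul_apply, smul_eq_mul]
    ring
  · intro k hk y
    rw [rankOneDiff_comm, hrow k hk, rankOneDiff_zero]

/-- Changing the first column, and the first row with it, adds two rank-one matrices. -/
theorem bordered_eq_add_cross (a : K) (v v₀ : Fin n → K) (M : Matrix (Fin n) (Fin n) K) :
    bordered σ a v M = bordered σ a v₀ M + vecMulVec (Fin.cons 0 (v - v₀)) (Pi.single 0 1)
      + vecMulVec (Pi.single 0 1) (Fin.cons 0 (σ ∘ (v - v₀))) := by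
  ext i j
  refine Fin.cases ?_ (fun i => ?_) i <;> refine Fin.cases ?_ (fun j => ?_) j <;>
    simp [vecMulVec_apply]

variable [Fintype K] {q : ℕ}

/-- On matrices with prescribed first row and column, the coefficient of the determinant is an
affine function of the corner. -/
theorem HermFun.exists_topDiff_bordered (h : QuadConj q σ)
    {f : Matrix (Fin (n + 1)) (Fin (n + 1)) K → K} (hf : HermFun σ f) (h0 : topDiff f ≠ 0) :
    ∃ c ≠ 0, ∃ a₀, σ a₀ = a₀ ∧
      ∀ a v M, topDiff (f ∘ bordered σ a v) M = c * (a - a₀) := by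
  set L := ((List.finRange n).map fun i => unitPair K i i).map liftPair with hL
  set G := iterDiff L f with hG
  have htop : topDiff f = rankOneDiff (Pi.single 0 1) (Pi.single 0 1) G := topDiff_eq f
  have hmem : ∀ k : Fin n, unitPair K k.succ k.succ ∈ L := by
    intro k
    rw [← liftPair_unitPair]
    exact List.mem_map_of_mem (List.mem_map_of_mem (List.mem_finRange k))
  have hGh : HermFun σ G := by
    refine hf.iterate h _ fun p hp => ?_
    simp only [hL, List.mem_map] at hp
    obtain ⟨_, ⟨k, _, rfl⟩, rfl⟩ := hp
    rw [liftPair_unitPair]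
    simp only [unitPair, comp_single]
  have hc : ∀ X, topDiff f X = topDiff f 0 := fun X => hf.affine.topDiff_const X 0
  have hc0 : topDiff f 0 ≠ 0 := by
    intro hz; apply h0; ext X; rw [hc, hz]; rfl
  have hcfix : σ (topDiff f 0) = topDiff f 0 := by
    have := (hGh.diff h (Pi.single 0 1)).fixed (isHerm_zero)
    rwa [comp_single, ← htop] at this
  refine ⟨topDiff f 0, hc0, -G 0 / topDiff f 0, ?_, fun a v M => ?_⟩
  · rw [map_div₀, map_neg, hGh.fixed isHerm_zero, hcfix]
  · have e1 : topDiff (f ∘ bordered σ a v) M = G (bordered σ a v M) := by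
      rw [topDiff, iterDiff_bordered]; rfl
    have e2 : G (bordered σ a v M) = G (0 + vecMulVec (a • Pi.single 0 1) (Pi.single 0 1)) := by
      have hne : ∀ i : Fin (n + 1), i ∉ Finset.univ.map (Fin.succEmb n) → i = 0 := by
        intro i
        refine Fin.cases (fun _ => rfl) (fun k hk => ?_) i
        exact absurd (Finset.mem_map_of_mem (Fin.succEmb n) (Finset.mem_univ k)) hk
      refine apply_eq_of_entries_eq (Finset.univ.map (Fin.succEmb n))
        (Finset.univ.map (Fin.succEmb n)) ?_ ?_ ?_
      · intro i hi y
        obtain ⟨k, _, rfl⟩ := Finset.mem_map.1 hi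
        exact hf.affine.iterDiff_inv_left (hmem k) y
      · intro i hi y
        obtain ⟨k, _, rfl⟩ := Finset.mem_map.1 hi
        exact hf.affine.iterDiff_inv_right (hmem k) y
      · intro i hi j hj
        rw [hne i hi, hne j hj]
        simp [vecMulVec_apply]
    rw [e1, e2, apply_add_vecMulVec G, hGh.affine.smul_left, ← htop, Pi.smul_apply, smul_eq_mul]
    field_simp
    ring

/-- When the determinant occurs in `f`, the restrictions of `f` to matrices with prescribed first
row and column and a given corner vanish for at most `q + 1` columns. Indeed the difference `d` of
two such columns satisfies `c d d* = d κᵀ + (d κᵀ)*`, where `c` is the coefficient of the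
determinant and `κ` does not depend on `d`. So `d` is zero if `κ` is; otherwise it is determined by
any coordinate at which `κ` is nonzero, which satisfies an equation of degree `q + 1`. -/
theorem HermFun.card_bordered_eq_zero_le [DecidableEq K] (h : QuadConj q σ)
    {f : Matrix (Fin (n + 1)) (Fin (n + 1)) K → K} (hf : HermFun σ f) (h0 : topDiff f ≠ 0)
    {a : K} (ha : σ a = a) (s : Finset (Fin n → K)) (hs : ∀ v ∈ s, f ∘ bordered σ a v = 0) :
    s.card ≤ q + 1 := by
  rcases s.eq_empty_or_nonempty with rfl | ⟨v₀, hv₀⟩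
  · simp
  set c := topDiff f 0 with hc
  have hcX : ∀ X, topDiff f X = c := fun X => hf.affine.topDiff_const X 0
  have hc0 : c ≠ 0 := by
    intro hz; apply h0; ext X; rw [hcX, hz]; rfl
  let U : List (Fin n) → List ((Fin (n + 1) → K) × (Fin (n + 1) → K)) :=
    fun l => (l.map fun k => unitPair K k k).map liftPair
  have hU : ∀ (k : Fin n) l, U (k :: l) = unitPair K k.succ k.succ :: U l := by
    intro k l; simp [U, liftPair_unitPair]
  have hUmem : ∀ (k : Fin n) l, k ∈ l → unitPair K k.succ k.succ ∈ U l := by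
    intro k l hk
    rw [← liftPair_unitPair]
    exact List.mem_map_of_mem (List.mem_map_of_mem hk)
  have hUperm : ∀ l l' : List (Fin n), l.Perm l' → iterDiff (U l) f = iterDiff (U l') f :=
    fun l l' hl => iterDiff_perm ((hl.map _).map _) f
  set X₀ := bordered σ a v₀ (0 : Matrix (Fin n) (Fin n) K) with hX₀
  have hX₀h : IsHerm σ X₀ := (isHerm_bordered h).2 ⟨ha, isHerm_zero⟩
  -- `g i` is the increment along all diagonal units except those at `0` and at `i`; as a function
  -- of the first row and column it involves their entries at `0` and `i` only
  let g : Fin n → Matrix (Fin (n + 1)) (Fin (n + 1)) K → K := fun i =>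
    iterDiff (U ((List.finRange n).erase i)) f
  have hga : ∀ i, RankOneAffine (g i) := fun i => hf.affine.iterate _
  have hgh : ∀ i, HermFun σ (g i) := fun i => hf.iterate h _ fun p hp => by
    simp only [U, List.mem_map] at hp
    obtain ⟨_, ⟨k, _, rfl⟩, rfl⟩ := hp
    rw [liftPair_unitPair]
    simp only [unitPair, comp_single]
  have hgtop : ∀ i, rankOneDiff (Pi.single 0 1) (Pi.single 0 1)
      (rankOneDiff (Pi.single i.succ 1) (Pi.single i.succ 1) (g i)) = topDiff f := by
    intro i
    rw [topDiff_eq]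
    congr 1
    have := hUperm _ _ (List.perm_cons_erase (List.mem_finRange i))
    rw [hU] at this
    exact this.symm
  let κ : Fin n → K := fun i => rankOneDiff (Pi.single i.succ 1) (Pi.single 0 1) (g i) X₀
  have hκ : ∀ i, rankOneDiff (Pi.single 0 1) (Pi.single i.succ 1) (g i) X₀ = σ (κ i) := by
    intro i
    have := (hgh i).diff_symm h (Pi.single 0 1) (Pi.single i.succ 1) X₀
    rwa [hX₀h.map_eq, comp_single, comp_single] at this
  have hmixed : ∀ i, rankOneDiff (Pi.single i.succ 1) (Pi.single 0 1)
      (rankOneDiff (Pi.single 0 1) (Pi.single i.succ 1) (g i)) X₀ = -c := by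
    intro i
    rw [(hga i).diff_swap, hgtop, Pi.neg_apply, hcX]
  have hnodup : ∀ i k : Fin n, k ∈ (List.finRange n).erase i ↔ k ≠ i := by
    intro i k
    rw [(List.nodup_finRange n).mem_erase_iff]
    simp
  have heq : ∀ v ∈ s, ∀ i j, c * ((v - v₀) j * σ ((v - v₀) i)) =
      κ i * (v - v₀) j + σ (κ j) * σ ((v - v₀) i) := by
    intro v hv i j
    by_cases hij : i = j
    · subst hij
      have hzero : ∀ w ∈ s, g i (bordered σ a w 0) = 0 := fun w hw =>
        iterDiff_liftPair_apply_eq_zero (hs w hw) _ 0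
      have hex := (hga i).apply_add_cross i i
        (fun k hk y => hf.affine.iterDiff_inv_left (hUmem k _ ((hnodup i k).2 hk)) y)
        (fun k hk y => hf.affine.iterDiff_inv_right (hUmem k _ ((hnodup i k).2 hk)) y)
        (v - v₀) (σ ∘ (v - v₀)) X₀
      rw [← bordered_eq_add_cross, hzero v hv, hzero v₀ hv₀, hκ, hmixed] at hex
      simp only [Function.comp_apply] at hex
      change _ = κ i * _ + _
      linear_combination hex
    · -- off the diagonal the same is done with `p`, the increment along the unit at `(i, j)` and
      -- along all diagonal units except those at `0`, `i` and `j`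
      set m := iterDiff (U (((List.finRange n).erase i).erase j)) f with hm
      have hma : RankOneAffine m := hf.affine.iterate _
      have hgi : g i = rankOneDiff (Pi.single j.succ 1) (Pi.single j.succ 1) m := by
        have := hUperm _ _ (List.perm_cons_erase ((hnodup i j).2 (Ne.symm hij)))
        rw [hU] at this
        exact this
      have hgj : g j = rankOneDiff (Pi.single i.succ 1) (Pi.single i.succ 1) m := by
        have := hUperm _ _ (List.perm_cons_erase ((hnodup j i).2 hij))
        rw [hU, List.erase_comm] at this
        exact this
      set p := rankOneDiff (Pi.single i.succ 1) (Pi.single j.succ 1) m with hp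
      have hpL : p = iterDiff ((unitPair K i j ::
          (((List.finRange n).erase i).erase j).map fun k => unitPair K k k).map liftPair) f := by
        rw [List.map_cons, iterDiff_cons, liftPair_unitPair]
        rfl
      have hzero : ∀ w ∈ s, p (bordered σ a w 0) = 0 := fun w hw => by
        rw [hpL]
        exact iterDiff_liftPair_apply_eq_zero (hs w hw) _ 0
      have hmem : ∀ k, k ≠ i → k ≠ j → k ∈ ((List.finRange n).erase i).erase j := by
        intro k hki hkj
        rw [((List.nodup_finRange n).erase i).mem_erase_iff]
        exact ⟨hkj, (hnodup i k).2 hki⟩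
      have hex := (hma.diff (Pi.single i.succ 1) (Pi.single j.succ 1)).apply_add_cross i j
        (fun k hk y => by
          by_cases hki : k = i
          · subst hki; exact hma.diff_right _ _ _
          · have hz : rankOneDiff (Pi.single k.succ 1) y m = 0 :=
              hf.affine.iterDiff_inv_left (hUmem k _ (hmem k hki hk)) y
            rw [rankOneDiff_comm, hz, rankOneDiff_zero])
        (fun k hk y => by
          by_cases hkj : k = j
          · subst hkj; exact hma.diff_left _ _ _
          · have hz : rankOneDiff y (Pi.single k.succ 1) m = 0 :=
              hf.affine.iterDiff_inv_right (hUmem k _ (hmem k hk hkj)) y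
            rw [rankOneDiff_comm, hz, rankOneDiff_zero])
        (v - v₀) (σ ∘ (v - v₀)) X₀
      rw [← hp, ← bordered_eq_add_cross, hzero v hv, hzero v₀ hv₀] at hex
      have h1 : rankOneDiff (Pi.single j.succ 1) (Pi.single 0 1) p =
          -rankOneDiff (Pi.single i.succ 1) (Pi.single 0 1) (g i) := by
        rw [hp, hma.diff_swap, hgi]
      have h2 : rankOneDiff (Pi.single 0 1) (Pi.single i.succ 1) p =
          -rankOneDiff (Pi.single 0 1) (Pi.single j.succ 1) (g j) := by
        rw [hp, hma.diff_swap, rankOneDiff_comm, hgj]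
      have h3 : rankOneDiff (Pi.single j.succ 1) (Pi.single 0 1)
          (rankOneDiff (Pi.single 0 1) (Pi.single i.succ 1) p) X₀ = c := by
        rw [h2, ← neg_one_smul K, rankOneDiff_smul, Pi.smul_apply, hmixed]
        simp
      rw [h3, h1, h2, Pi.neg_apply, Pi.neg_apply, hκ] at hex
      simp only [Function.comp_apply] at hex
      change _ = κ i * _ + _
      have : rankOneDiff (Pi.single i.succ 1) (Pi.single 0 1) (g i) X₀ = κ i := rfl
      rw [this] at hex
      linear_combination -hex
  by_cases hκ0 : ∀ i, κ i = 0
  · refine le_trans (Finset.card_le_card (t := {v₀}) fun v hv => ?_) (by simp)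
    rw [Finset.mem_singleton, ← sub_eq_zero]
    ext i
    have h1 := heq v hv i i
    rw [hκ0, map_zero, zero_mul, zero_mul, add_zero] at h1
    rcases mul_eq_zero.1 ((mul_eq_zero.1 h1).resolve_left hc0) with h2 | h2
    · exact h2
    · exact (map_eq_zero σ).1 h2
  · push Not at hκ0
    obtain ⟨i, hi⟩ := hκ0
    refine le_trans (Finset.card_le_card_of_injOn (fun v => (v - v₀) i) ?_ ?_)
      (h.card_circle_le (c := c) (κ := κ i) (κ' := σ (κ i)) (e := 0) hc0)
    · intro v hv
      simpa using heq v hv i i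
    · intro v hv w hw hvw
      simp only at hvw
      have hne : c * σ ((v - v₀) i) - κ i ≠ 0 := by
        intro hz
        have h1 := heq v hv i i
        have h2 : σ (κ i) * σ ((v - v₀) i) = 0 := by linear_combination -h1 + (v - v₀) i * hz
        rcases mul_eq_zero.1 h2 with h3 | h3
        · exact hi (by simpa using h3)
        · rw [h3] at hz
          exact hi (by simpa using hz)
      rw [← sub_left_inj (a := v₀)]
      ext j
      have h1 := heq v hv i j
      have h2 := heq w hw i j
      rw [← hvw] at h2
      apply mul_left_cancel₀ hne
      linear_combination h1 - h2

end

/-! ### Counting zeros, and dimensions at most two -/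

section

variable {K : Type*} [Field K] {n : ℕ} {σ : K →+* K}

theorem hermZeros_eq_zero_of_ne {f : Matrix (Fin n) (Fin n) K → K} (hf : ∀ X, f X ≠ 0) :
    hermZeros σ f = 0 := by
  have : IsEmpty {X : Matrix (Fin n) (Fin n) K // IsHerm σ X ∧ f X = 0} := ⟨fun X => hf _ X.2.2⟩
  simp [hermZeros]

theorem hermZeros_dim_zero {f : Matrix (Fin 0) (Fin 0) K → K} (hf : f ≠ 0) :
    hermZeros σ f = 0 := by
  refine hermZeros_eq_zero_of_ne fun X hX => hf ?_
  ext Y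
  rw [Subsingleton.elim Y X, hX]; rfl

/-- In dimension one a function without linear term is constant. -/
theorem RankOneAffine.hermZeros_dim_one_of_topDiff_eq {f : Matrix (Fin 1) (Fin 1) K → K}
    (hf : RankOneAffine f) (h0 : topDiff f = 0) (hne : f ≠ 0) : hermZeros σ f = 0 := by
  have hconst : ∀ X Y, f X = f Y := hf.eq_const fun i j => by
    rw [Subsingleton.elim i 0, Subsingleton.elim j 0]; exact h0
  refine hermZeros_eq_zero_of_ne fun X hX => hne ?_
  ext Y
  rw [hconst Y X, hX]; rfl

/-- A function whose second increments all vanish is affine. -/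
theorem RankOneAffine.eq_affine {f : Matrix (Fin n) (Fin n) K → K} (hf : RankOneAffine f)
    (h0 : ∀ i j k m : Fin n, rankOneDiff (Pi.single i 1) (Pi.single j 1)
      (rankOneDiff (Pi.single k 1) (Pi.single m 1) f) = 0) (X : Matrix (Fin n) (Fin n) K) :
    f X = f 0 + ∑ i, ∑ j, X i j * rankOneDiff (Pi.single i 1) (Pi.single j 1) f 0 := by
  have hconst : ∀ k m X, rankOneDiff (Pi.single k 1) (Pi.single m 1) f X =
      rankOneDiff (Pi.single k 1) (Pi.single m 1) f 0 :=
    fun k m X => (hf.diff _ _).eq_const (fun i j => h0 i j k m) X 0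
  have hrow : ∀ i (y : Fin n → K) X, rankOneDiff (Pi.single i 1) y f X =
      ∑ j, y j * rankOneDiff (Pi.single i 1) (Pi.single j 1) f 0 := by
    intro i y X
    have hy : y = ∑ j, y j • (Pi.single j 1 : Fin n → K) := by
      ext k; simp [Finset.sum_apply, Pi.single_apply]
    have : ∀ S : Finset (Fin n), rankOneDiff (Pi.single i 1)
        (∑ j ∈ S, y j • (Pi.single j 1 : Fin n → K)) f X =
        ∑ j ∈ S, y j * rankOneDiff (Pi.single i 1) (Pi.single j 1) f 0 := by
      intro S
      induction S using Finset.induction_on with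
      | empty => simp [hf.zero_right]
      | insert a S ha ih =>
        rw [Finset.sum_insert ha, hf.add_right, Pi.add_apply, ih, hf.smul_right, Pi.smul_apply,
          hconst, Finset.sum_insert ha, smul_eq_mul]
    conv_lhs => rw [hy]
    exact this _
  have key : ∀ S : Finset (Fin n), f (∑ i ∈ S, vecMulVec (Pi.single i 1) (X i)) =
      f 0 + ∑ i ∈ S, ∑ j, X i j * rankOneDiff (Pi.single i 1) (Pi.single j 1) f 0 := by
    intro S
    induction S using Finset.induction_on with
    | empty => simp
    | insert a S ha ih =>
      rw [Finset.sum_insert ha, add_comm, apply_add_vecMulVec f, ih, hrow, Finset.sum_insert ha]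
      ring
  have hX : X = ∑ i, vecMulVec (Pi.single i 1) (X i) := by
    ext i j; simp [Matrix.sum_apply, vecMulVec_apply, Pi.single_apply]
  conv_lhs => rw [hX]
  exact key _

theorem RankOneAffine.dim_two_eq_affine {f : Matrix (Fin 2) (Fin 2) K → K} (hf : RankOneAffine f)
    (h0 : topDiff f = 0) : ∃ e A B C D : K,
      ∀ X, f X = e + A * X 0 0 + B * X 0 1 + C * X 1 0 + D * X 1 1 := by
  have h1 : rankOneDiff (Pi.single 0 1) (Pi.single 0 1)
      (rankOneDiff (Pi.single 1 1) (Pi.single 1 1) f) = 0 := h0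
  have h2 : rankOneDiff (Pi.single 0 1) (Pi.single 1 1)
      (rankOneDiff (Pi.single 1 1) (Pi.single 0 1) f) = 0 := by
    rw [hf.diff_swap, rankOneDiff_comm, h1, neg_zero]
  have h3 : ∀ i j k m : Fin 2, rankOneDiff (Pi.single i 1) (Pi.single j 1)
      (rankOneDiff (Pi.single k 1) (Pi.single m 1) f) = 0 := by
    intro i j k m
    by_cases hik : i = k
    · subst hik; exact hf.diff_right _ _ _
    by_cases hjm : j = m
    · subst hjm; exact hf.diff_left _ _ _
    fin_cases i <;> fin_cases j <;> fin_cases k <;> fin_cases m <;> simp at hik hjm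
    · exact h1
    · exact h2
    · rw [rankOneDiff_comm]; exact h2
    · rw [rankOneDiff_comm]; exact h1
  let d : Fin 2 → Fin 2 → K := fun i j => rankOneDiff (Pi.single i 1) (Pi.single j 1) f 0
  refine ⟨f 0, d 0 0, d 0 1, d 1 0, d 1 1, fun X => ?_⟩
  rw [hf.eq_affine h3 X]
  simp only [Fin.sum_univ_two, mul_comm (X _ _), ← add_assoc, d]

end

section

variable {K : Type*} [Field K] [Fintype K] [DecidableEq K] {n : ℕ} {σ : K →+* K} {q : ℕ}

theorem hermZeros_le_of_fibres (h : QuadConj q σ)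
    {f : Matrix (Fin (n + 1)) (Fin (n + 1)) K → K} {B : ℝ}
    (hB : ∀ a v, σ a = a → (hermZeros σ (f ∘ bordered σ a v) : ℝ) ≤ B) :
    (hermZeros σ f : ℝ) ≤ q * q ^ (2 * n) * B := by
  rw [hermZeros_eq_sum h]
  push_cast
  calc _ ≤ ∑ a : FixedBy σ, ∑ v : Fin n → K, B :=
        Finset.sum_le_sum fun a _ => Finset.sum_le_sum fun v _ => hB a.1 v a.2
    _ = _ := by
        simp only [Finset.sum_const, Finset.card_univ, h.card_fixed, Fintype.card_fun, h.card,
          Fintype.card_fin, nsmul_eq_mul, ← pow_mul]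
        push_cast
        ring

/-- The count of Hermitian zeros by first row and column, with one exceptional value `a₀` of the
corner, at which at most `s` restrictions vanish identically. -/
theorem hermZeros_le_of_corner (h : QuadConj q σ)
    {f : Matrix (Fin (n + 1)) (Fin (n + 1)) K → K} {a₀ : K} (ha₀ : σ a₀ = a₀) {B B' : ℝ} {s : ℕ}
    (hB : ∀ a v, σ a = a → a ≠ a₀ → (hermZeros σ (f ∘ bordered σ a v) : ℝ) ≤ B)
    (hB' : ∀ v, f ∘ bordered σ a₀ v ≠ 0 → (hermZeros σ (f ∘ bordered σ a₀ v) : ℝ) ≤ B')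
    (hN : B' ≤ q ^ n ^ 2)
    (hs : ∀ S : Finset (Fin n → K), (∀ v ∈ S, f ∘ bordered σ a₀ v = 0) → S.card ≤ s) :
    (hermZeros σ f : ℝ) ≤
      (q - 1) * q ^ (2 * n) * B + q ^ (2 * n) * B' + s * (q ^ n ^ 2 - B') := by
  classical
  rw [hermZeros_eq_sum h]
  push_cast
  rw [← Finset.add_sum_erase Finset.univ _ (Finset.mem_univ (⟨a₀, ha₀⟩ : FixedBy σ))]
  have hq : 1 ≤ q := by have := h.two_le; omega
  have h1 : ∑ a ∈ Finset.univ.erase (⟨a₀, ha₀⟩ : FixedBy σ), ∑ v : Fin n → K,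
      (hermZeros σ (f ∘ bordered σ a.1 v) : ℝ) ≤ (q - 1) * q ^ (2 * n) * B := by
    calc _ ≤ ∑ a ∈ Finset.univ.erase (⟨a₀, ha₀⟩ : FixedBy σ), ∑ v : Fin n → K, B :=
          Finset.sum_le_sum fun a ha => Finset.sum_le_sum fun v _ => hB a.1 v a.2 fun e =>
            Finset.ne_of_mem_erase ha (Subtype.ext e)
      _ = _ := by
          rw [Finset.sum_const, Finset.card_erase_of_mem (Finset.mem_univ _)]
          simp only [Finset.sum_const, Finset.card_univ, h.card_fixed, Fintype.card_fun, h.card,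
            Fintype.card_fin, nsmul_eq_mul, ← pow_mul]
          push_cast [hq]
          ring
  have h2 : ∑ v : Fin n → K, (hermZeros σ (f ∘ bordered σ a₀ v) : ℝ) ≤
      q ^ (2 * n) * B' + s * (q ^ n ^ 2 - B') := by
    calc _ ≤ ∑ v : Fin n → K,
          (B' + if f ∘ bordered σ a₀ v = 0 then (q ^ n ^ 2 - B' : ℝ) else 0) := by
          refine Finset.sum_le_sum fun v _ => ?_
          split_ifs with hv
          · have := hermZeros_le h (f ∘ bordered σ a₀ v)
            rw [add_sub_cancel]
            exact_mod_cast this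
          · simpa using hB' v hv
      _ ≤ _ := by
          rw [Finset.sum_add_distrib, ← Finset.sum_filter, Finset.sum_const, Finset.sum_const]
          have hc := hs (Finset.univ.filter fun v => f ∘ bordered σ a₀ v = 0) (by simp)
          simp only [Finset.card_univ, Fintype.card_fun, h.card, Fintype.card_fin, nsmul_eq_mul,
            ← pow_mul]
          push_cast
          gcongr
  linarith

theorem HermFun.hermZeros_dim_one_of_topDiff_ne (h : QuadConj q σ)
    {f : Matrix (Fin 1) (Fin 1) K → K} (hf : HermFun σ f) (h0 : topDiff f ≠ 0) :
    hermZeros σ f ≤ 1 := by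
  obtain ⟨c, hc, a₀, ha₀, htop⟩ := hf.exists_topDiff_bordered h h0
  have := hermZeros_le_of_corner h (f := f) ha₀ (B := 0) (B' := 0) (s := 1) ?_ ?_ (by positivity) ?_
  · simpa using this
  · intro a v _ ha
    rw [hermZeros_dim_zero, Nat.cast_zero]
    intro hz
    have := htop a v 0
    rw [hz] at this
    exact mul_ne_zero hc (sub_ne_zero.2 ha) this.symm
  · intro v hv
    rw [hermZeros_dim_zero hv, Nat.cast_zero]
  · intro S _
    exact (Finset.card_le_univ S).trans (by simp)

theorem HermFun.hermZeros_dim_two_of_topDiff_ne (h : QuadConj q σ)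
    {f : Matrix (Fin 2) (Fin 2) K → K} (hf : HermFun σ f) (h0 : topDiff f ≠ 0) :
    (hermZeros σ f : ℝ) ≤ q ^ 3 + q := by
  obtain ⟨c, hc, a₀, ha₀, htop⟩ := hf.exists_topDiff_bordered h h0
  have := hermZeros_le_of_corner h (f := f) ha₀ (B := 1) (B' := 0) (s := q + 1) ?_ ?_
    (by positivity) fun S hS => hf.card_bordered_eq_zero_le h h0 ha₀ S hS
  · refine this.trans (le_of_eq ?_)
    push_cast
    ring
  · intro a v hσ ha
    have hne : topDiff (f ∘ bordered σ a v) ≠ 0 := by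
      intro hz
      have := htop a v 0
      rw [hz] at this
      exact mul_ne_zero hc (sub_ne_zero.2 ha) this.symm
    exact_mod_cast (hf.comp_bordered h hσ v).hermZeros_dim_one_of_topDiff_ne h hne
  · intro v hv
    have hz : topDiff (f ∘ bordered σ a₀ v) = 0 := by
      ext M; rw [htop, sub_self, mul_zero]; rfl
    rw [(hf.affine.comp_bordered a₀ v).hermZeros_dim_one_of_topDiff_eq hz hv, Nat.cast_zero]

/-- Without the determinant, a function in dimension two is a nonzero affine function, whose
Hermitian zeros fill at most a hyperplane over the fixed field. -/
theorem HermFun.hermZeros_dim_two_of_topDiff_eq (h : QuadConj q σ)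
    {f : Matrix (Fin 2) (Fin 2) K → K} (hf : HermFun σ f) (h0 : topDiff f = 0) (hne : f ≠ 0) :
    (hermZeros σ f : ℝ) ≤ q ^ 3 := by
  obtain ⟨e, A, B, C, D, hfX⟩ := hf.affine.dim_two_eq_affine h0
  by_cases hD : D = 0
  · -- `f` does not involve the last diagonal entry
    have hfib : ∀ a (v : Fin 1 → K), hermZeros σ (f ∘ bordered σ a v) ≤
        if e + A * a + B * σ (v 0) + C * v 0 = 0 then q else 0 := by
      intro a v
      have hval : ∀ M, (f ∘ bordered σ a v) M = e + A * a + B * σ (v 0) + C * v 0 := by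
        intro M
        rw [Function.comp_apply, hfX, hD, zero_mul, add_zero]
        rfl
      split_ifs with hc
      · simpa using hermZeros_le h (f ∘ bordered σ a v)
      · rw [hermZeros_eq_zero_of_ne fun M => by rw [hval]; exact hc]
    have hsum : hermZeros σ f ≤ ∑ a : FixedBy σ, ∑ v : Fin 1 → K,
        if e + A * a.1 + B * σ (v 0) + C * v 0 = 0 then q else 0 := by
      rw [hermZeros_eq_sum h]
      exact Finset.sum_le_sum fun a _ => Finset.sum_le_sum fun v _ => hfib a.1 v
    have : hermZeros σ f ≤ q ^ 3 := by
      refine hsum.trans ?_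
      by_cases hA : A = 0
      · have hne' : B ≠ 0 ∨ C ≠ 0 ∨ e ≠ 0 := by
          by_contra hcon
          push Not at hcon
          apply hne
          ext X
          rw [hfX, hA, hD, hcon.1, hcon.2.1, hcon.2.2]
          simp
        calc _ ≤ ∑ _a : FixedBy σ, q * q := by
              refine Finset.sum_le_sum fun a _ => ?_
              rw [← Finset.sum_filter, Finset.sum_const, smul_eq_mul]
              refine Nat.mul_le_mul_right q (le_trans ?_ (h.card_linear_le hne'))
              refine Finset.card_le_card_of_injOn (fun v => v 0) ?_ ?_
              · intro v hv
                simp only [Finset.coe_filter, Finset.mem_univ, true_and, Set.mem_ofPred_eq, hA,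
                  zero_mul, add_zero] at hv ⊢
                rw [← hv]; ring
              · intro v _ w _ hvw
                ext i
                rw [Subsingleton.elim i 0]; exact hvw
          _ = q ^ 3 := by
              simp only [Finset.sum_const, Finset.card_univ, h.card_fixed, smul_eq_mul]
              ring
      · rw [Finset.sum_comm]
        calc _ ≤ ∑ _v : Fin 1 → K, q := by
              refine Finset.sum_le_sum fun v _ => ?_
              rw [← Finset.sum_filter, Finset.sum_const, smul_eq_mul]
              refine (Nat.mul_le_mul_right q (?_ : _ ≤ 1)).trans (by simp)
              refine Finset.card_le_one.2 fun a ha b hb => Subtype.ext ?_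
              simp only [Finset.mem_filter, Finset.mem_univ, true_and] at ha hb
              apply mul_left_cancel₀ hA
              linear_combination ha - hb
          _ = q ^ 3 := by
              simp only [Finset.sum_const, Finset.card_univ, Fintype.card_fun, h.card,
                Fintype.card_fin, smul_eq_mul]
              ring
    exact_mod_cast this
  · -- the last diagonal entry is determined by the other entries
    have hfib : ∀ a v, σ a = a → (hermZeros σ (f ∘ bordered σ a v) : ℝ) ≤ 1 := by
      intro a v ha
      have hne' : topDiff (f ∘ bordered σ a v) ≠ 0 := by
        intro hz
        have : topDiff (f ∘ bordered σ a v) 0 = D := by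
          change (f ∘ bordered σ a v) _ - (f ∘ bordered σ a v) 0 = D
          simp only [Function.comp_apply, hfX]
          have e1 : ∀ M : Matrix (Fin 1) (Fin 1) K, bordered σ a v M 1 1 = M 0 0 := fun _ => rfl
          have e2 : ∀ M : Matrix (Fin 1) (Fin 1) K, bordered σ a v M 0 0 = a := fun _ => rfl
          have e3 : ∀ M : Matrix (Fin 1) (Fin 1) K, bordered σ a v M 0 1 = σ (v 0) := fun _ => rfl
          have e4 : ∀ M : Matrix (Fin 1) (Fin 1) K, bordered σ a v M 1 0 = v 0 := fun _ => rfl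
          simp [e1, e2, e3, e4, unitPair, vecMulVec_apply]
        rw [hz] at this
        exact hD this.symm
      exact_mod_cast (hf.comp_bordered h ha v).hermZeros_dim_one_of_topDiff_ne h hne'
    refine (hermZeros_le_of_fibres h hfib).trans (le_of_eq ?_)
    ring

end

/-! ### Minors, and functions in dimension three -/

section

variable {K : Type*} [Field K]

/-- The increment of the determinant along `u vᵀ` is the bordered determinant with border `v`, `-u`
and corner `0`, which is visibly linear in `v`. -/
theorem det_add_vecMulVec_sub_det {k : ℕ} (A : Matrix (Fin k) (Fin k) K) (u v : Fin k → K) :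
    (A + vecMulVec u v).det - A.det =
      (updateRow (fromBlocks (1 : Matrix Unit Unit K) 0 (replicateCol Unit (-u)) A) (Sum.inl ())
        (Sum.elim 0 v)).det := by
  have h1 : ∀ w : Fin k → K, updateRow (fromBlocks (1 : Matrix Unit Unit K) 0
      (replicateCol Unit (-u)) A) (Sum.inl ()) (Sum.elim 1 w) =
      fromBlocks 1 (replicateRow Unit w) (replicateCol Unit (-u)) A := by
    intro w
    ext i j
    rcases i with ⟨⟩ | i
    · rcases j with ⟨⟩ | j <;> simp
    · rcases j with ⟨⟩ | j <;> simp
  have h2 : ∀ w : Fin k → K, (updateRow (fromBlocks (1 : Matrix Unit Unit K) 0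
      (replicateCol Unit (-u)) A) (Sum.inl ()) (Sum.elim 1 w)).det = (A + vecMulVec u w).det := by
    intro w
    rw [h1, det_fromBlocks_one₁₁]
    congr 1
    ext i j
    simp [Matrix.mul_apply, vecMulVec_apply]
  have h3 : (Sum.elim 1 v : Unit ⊕ Fin k → K) =
      Sum.elim (1 : Unit → K) (0 : Fin k → K) + Sum.elim (0 : Unit → K) v := by
    ext (_ | i) <;> simp
  have h4 := h2 0
  rw [vecMulVec_zero, add_zero] at h4
  rw [← h2 v, h3, det_updateRow_add, h4]
  ring

theorem det_diff_add {k : ℕ} (A : Matrix (Fin k) (Fin k) K) (u v v' : Fin k → K) :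
    (A + vecMulVec u (v + v')).det - A.det =
      ((A + vecMulVec u v).det - A.det) + ((A + vecMulVec u v').det - A.det) := by
  simp only [det_add_vecMulVec_sub_det]
  rw [← det_updateRow_add]
  congr 2
  ext (_ | i) <;> simp

theorem det_diff_smul {k : ℕ} (A : Matrix (Fin k) (Fin k) K) (c : K) (u v : Fin k → K) :
    (A + vecMulVec u (c • v)).det - A.det = c * ((A + vecMulVec u v).det - A.det) := by
  simp only [det_add_vecMulVec_sub_det]
  rw [← det_updateRow_smul]
  congr 2
  ext (_ | i) <;> simp

theorem det_add_vecMulVec_transpose {k : ℕ} (A : Matrix (Fin k) (Fin k) K) (u v : Fin k → K) :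
    (A + vecMulVec u v).det = (Aᵀ + vecMulVec v u).det := by
  rw [← det_transpose, transpose_add]
  congr 2
  ext i j
  simp [vecMulVec_apply, mul_comm]

/-- Minors are rank-one affine. -/
theorem RankOneAffine.minor {n k : ℕ} (r s : Fin k → Fin n) :
    RankOneAffine fun X : Matrix (Fin n) (Fin n) K => (X.submatrix r s).det := by
  have e : ∀ (X : Matrix (Fin n) (Fin n) K) u v, (X + vecMulVec u v).submatrix r s =
      X.submatrix r s + vecMulVec (u ∘ r) (v ∘ s) := by
    intro X u v; ext i j; simp [vecMulVec_apply]
  have c1 : ∀ (u v : Fin n → K) (t : Fin k → Fin n), (u + v) ∘ t = u ∘ t + v ∘ t :=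
    fun _ _ _ => rfl
  have c2 : ∀ (c : K) (u : Fin n → K) (t : Fin k → Fin n), (c • u) ∘ t = c • (u ∘ t) :=
    fun _ _ _ => rfl
  constructor
  · intro u u' v
    ext X
    simp only [rankOneDiff, Pi.add_apply, e, c1]
    have := det_diff_add (X.submatrix r s)ᵀ (v ∘ s) (u ∘ r) (u' ∘ r)
    simpa only [← det_add_vecMulVec_transpose, det_transpose] using this
  · intro c u v
    ext X
    simp only [rankOneDiff, Pi.smul_apply, e, c2, smul_eq_mul]
    have := det_diff_smul (X.submatrix r s)ᵀ c (v ∘ s) (u ∘ r)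
    simpa only [← det_add_vecMulVec_transpose, det_transpose] using this
  · intro u v v'
    ext X
    simp only [rankOneDiff, Pi.add_apply, e, c1]
    exact det_diff_add _ _ _ _
  · intro c u v
    ext X
    simp only [rankOneDiff, Pi.smul_apply, e, c2, smul_eq_mul]
    exact det_diff_smul _ _ _ _

theorem RankOneAffine.det {n : ℕ} :
    RankOneAffine fun X : Matrix (Fin n) (Fin n) K => X.det := by
  simpa using RankOneAffine.minor (K := K) (n := n) id id

theorem RankOneAffine.comp_add {n : ℕ} {f : Matrix (Fin n) (Fin n) K → K} (hf : RankOneAffine f)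
    (T : Matrix (Fin n) (Fin n) K) : RankOneAffine fun X => f (X + T) :=
  hf.comp (fun X => X + T) LinearMap.id LinearMap.id fun X u v => by
    simp [add_right_comm]

end

section dimThree

variable {K : Type*} [Field K]

/-- The second increment along the rows other than `r` and the columns other than `s`, both taken in
cyclic order. -/
def minorDiff (f : Matrix (Fin 3) (Fin 3) K → K) (r s : Fin 3) : Matrix (Fin 3) (Fin 3) K → K :=
  rankOneDiff (Pi.single (r + 1) 1) (Pi.single (s + 1) 1)
    (rankOneDiff (Pi.single (r + 2) 1) (Pi.single (s + 2) 1) f)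

/-- Second increments read off the entries of a translation of the determinant, since the
coefficients of the `2 × 2` minors in `det (X + T)` are the entries of `T` up to sign. The cyclic
order accounts for the signs. -/
theorem minorDiff_det (T : Matrix (Fin 3) (Fin 3) K) (r s : Fin 3) :
    minorDiff (fun X => (X + T).det) r s 0 = T r s := by
  have e : ∀ (g : Matrix (Fin 3) (Fin 3) K → K), minorDiff g r s 0 =
    g (0 + vecMulVec (Pi.single (r + 1) 1) (Pi.single (s + 1) 1) +
        vecMulVec (Pi.single (r + 2) 1) (Pi.single (s + 2) 1)) -
      g (0 + vecMulVec (Pi.single (r + 1) 1) (Pi.single (s + 1) 1)) -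
      (g (0 + vecMulVec (Pi.single (r + 2) 1) (Pi.single (s + 2) 1)) - g 0) := fun g => rfl
  rw [e]
  simp only [det_fin_three]
  fin_cases r <;> fin_cases s <;>
    simp [vecMulVec_apply, Fin.ext_iff] <;> ring

theorem topDiff_det (T : Matrix (Fin 3) (Fin 3) K) (X : Matrix (Fin 3) (Fin 3) K) :
    topDiff (fun X => (X + T).det) X = 1 := by
  rw [(RankOneAffine.det.comp_add T).topDiff_const X 0]
  have e : ∀ g : Matrix (Fin 3) (Fin 3) K → K, topDiff g 0 =
      minorDiff g 0 0 (vecMulVec (Pi.single 0 1) (Pi.single 0 1)) - minorDiff g 0 0 0 := by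
    intro g
    rw [← zero_add (vecMulVec (Pi.single 0 1) (Pi.single 0 1))]
    rfl
  have e2 : minorDiff (fun X => (X + T).det) 0 0 (vecMulVec (Pi.single 0 1) (Pi.single 0 1)) =
      minorDiff (fun X => (X + (T + vecMulVec (Pi.single 0 1) (Pi.single 0 1))).det) 0 0 0 := by
    simp only [minorDiff, rankOneDiff]
    simp only [zero_add, add_assoc, add_comm, add_left_comm]
  rw [e, e2, minorDiff_det, minorDiff_det]
  simp [vecMulVec_apply]

theorem eq_zero_of_alternating {M : Type*} [AddCommGroup M] (t : Fin 3 → Fin 3 → Fin 3 → M)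
    (s1 : ∀ i j k, t i j k = -t j i k) (s2 : ∀ i j k, t i j k = -t i k j) (d1 : ∀ i k, t i i k = 0)
    (t0 : t 0 1 2 = 0) (i j k : Fin 3) : t i j k = 0 := by
  have d2 : ∀ i k, t i k i = 0 := fun i k => by rw [s2, d1, neg_zero]
  have d3 : ∀ i k, t i k k = 0 := fun i k => by rw [s1, d2, neg_zero]
  have t1 : t 0 2 1 = 0 := by rw [s2, t0, neg_zero]
  have t2 : t 1 0 2 = 0 := by rw [s1, t0, neg_zero]
  have t3 : t 1 2 0 = 0 := by rw [s2, t2, neg_zero]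
  have t4 : t 2 0 1 = 0 := by rw [s1, t1, neg_zero]
  have t5 : t 2 1 0 = 0 := by rw [s2, t4, neg_zero]
  have hcases : i = j ∨ i = k ∨ j = k ∨ (i = 0 ∧ j = 1 ∧ k = 2) ∨ (i = 0 ∧ j = 2 ∧ k = 1) ∨
      (i = 1 ∧ j = 0 ∧ k = 2) ∨ (i = 1 ∧ j = 2 ∧ k = 0) ∨ (i = 2 ∧ j = 0 ∧ k = 1) ∨
      (i = 2 ∧ j = 1 ∧ k = 0) := by
    revert i j k; decide
  rcases hcases with rfl | rfl | rfl | ⟨rfl, rfl, rfl⟩ | ⟨rfl, rfl, rfl⟩ | ⟨rfl, rfl, rfl⟩ |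
    ⟨rfl, rfl, rfl⟩ | ⟨rfl, rfl, rfl⟩ | ⟨rfl, rfl, rfl⟩
  · exact d1 _ _
  · exact d2 _ _
  · exact d3 _ _
  all_goals assumption

/-- If the determinant does not occur in `f`, all third coordinate increments vanish. -/
theorem RankOneAffine.third_diff_eq_zero {f : Matrix (Fin 3) (Fin 3) K → K} (hf : RankOneAffine f)
    (h0 : topDiff f = 0) (i j k : Fin 3) :
    rankOneDiff (Pi.single 0 1) (Pi.single i 1) (rankOneDiff (Pi.single 1 1) (Pi.single j 1)
      (rankOneDiff (Pi.single 2 1) (Pi.single k 1) f)) = 0 := by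
  refine eq_zero_of_alternating (fun i j k => rankOneDiff (Pi.single 0 1) (Pi.single i 1)
    (rankOneDiff (Pi.single 1 1) (Pi.single j 1) (rankOneDiff (Pi.single 2 1) (Pi.single k 1) f)))
    ?_ ?_ ?_ h0 i j k
  · intro i j k
    rw [(hf.diff (Pi.single 2 1) (Pi.single k 1)).diff_swap (Pi.single 0 1) (Pi.single i 1)
      (Pi.single 1 1) (Pi.single j 1),
      rankOneDiff_comm (Pi.single 1 1) (Pi.single i 1) (Pi.single 0 1) (Pi.single j 1)]
  · intro i j k
    rw [hf.diff_swap (Pi.single 1 1) (Pi.single j 1) (Pi.single 2 1) (Pi.single k 1),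
      ← neg_one_smul K, rankOneDiff_smul, neg_one_smul,
      rankOneDiff_comm (Pi.single 2 1) (Pi.single j 1) (Pi.single 1 1) (Pi.single k 1)]
  · intro i k
    exact (hf.diff _ _).diff_left _ _ _

/-- If the determinant does not occur in `f`, the second increments are constant: they are the
coefficients of the `2 × 2` minors. -/
theorem RankOneAffine.minorDiff_const {f : Matrix (Fin 3) (Fin 3) K → K} (hf : RankOneAffine f)
    (h0 : topDiff f = 0) (r s : Fin 3) (X : Matrix (Fin 3) (Fin 3) K) :
    minorDiff f r s X = minorDiff f r s 0 := by
  refine ((hf.diff _ _).diff _ _).eq_const (fun i j => ?_) X 0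
  have hi : i = r ∨ i = r + 1 ∨ i = r + 2 := by revert i r; decide
  rcases hi with rfl | rfl | rfl
  · have ht := hf.third_diff_eq_zero h0
    have hi : i = 0 ∨ i = 1 ∨ i = 2 := by revert i; decide
    rcases hi with rfl | rfl | rfl
    · exact ht _ _ _
    · change rankOneDiff (Pi.single 1 1) _ (rankOneDiff (Pi.single 2 1) _
        (rankOneDiff (Pi.single 0 1) _ f)) = 0
      rw [rankOneDiff_comm (Pi.single 2 1) _ (Pi.single 0 1),
        rankOneDiff_comm (Pi.single 1 1) _ (Pi.single 0 1)]
      exact ht _ _ _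
    · change rankOneDiff (Pi.single 2 1) _ (rankOneDiff (Pi.single 0 1) _
        (rankOneDiff (Pi.single 1 1) _ f)) = 0
      rw [rankOneDiff_comm (Pi.single 2 1) _ (Pi.single 0 1),
        rankOneDiff_comm (Pi.single 2 1) _ (Pi.single 1 1)]
      exact ht _ _ _
  · exact (hf.diff _ _).diff_right _ _ _
  · rw [rankOneDiff_comm, hf.diff_right, rankOneDiff_zero]

theorem RankOneAffine.second_diff_eq_zero {f : Matrix (Fin 3) (Fin 3) K → K} (hf : RankOneAffine f)
    (h0 : topDiff f = 0) (h1 : ∀ r s, minorDiff f r s 0 = 0) (i j k m : Fin 3) :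
    rankOneDiff (Pi.single i 1) (Pi.single j 1)
      (rankOneDiff (Pi.single k 1) (Pi.single m 1) f) = 0 := by
  have hm : ∀ r s, rankOneDiff (Pi.single (r + 1) 1) (Pi.single (s + 1) 1)
      (rankOneDiff (Pi.single (r + 2) 1) (Pi.single (s + 2) 1) f) = 0 := fun r s => by
    ext X
    exact (hf.minorDiff_const h0 r s X).trans (h1 r s)
  have hm' : ∀ r s, rankOneDiff (Pi.single (r + 1) 1) (Pi.single (s + 2) 1)
      (rankOneDiff (Pi.single (r + 2) 1) (Pi.single (s + 1) 1) f) = 0 := fun r s => by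
    rw [hf.diff_swap, rankOneDiff_comm, hm, neg_zero]
  have hpair : ∀ i k : Fin 3, i = k ∨ ∃ r, (i = r + 1 ∧ k = r + 2) ∨ (i = r + 2 ∧ k = r + 1) := by
    decide
  rcases hpair i k with rfl | ⟨r, ⟨rfl, rfl⟩ | ⟨rfl, rfl⟩⟩
  · exact hf.diff_right _ _ _
  all_goals rcases hpair j m with rfl | ⟨s, ⟨rfl, rfl⟩ | ⟨rfl, rfl⟩⟩
  · exact hf.diff_left _ _ _
  · exact hm r s
  · exact hm' r s
  · exact hf.diff_left _ _ _
  · rw [rankOneDiff_comm]; exact hm' r s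
  · rw [rankOneDiff_comm]; exact hm r s

end dimThree

/-! ### The bound in dimension three -/

section

variable {K : Type*} [Field K] {σ : K →+* K}

theorem iterDiff_add {n : ℕ} (L) (f g : Matrix (Fin n) (Fin n) K → K) :
    iterDiff L (f + g) = iterDiff L f + iterDiff L g := by
  induction L with
  | nil => rfl
  | cons p L ih => simp only [iterDiff_cons, ih, rankOneDiff_add]

theorem iterDiff_smul {n : ℕ} (L) (c : K) (f : Matrix (Fin n) (Fin n) K → K) :
    iterDiff L (c • f) = c • iterDiff L f := by
  induction L with
  | nil => rfl
  | cons p L ih => simp only [iterDiff_cons, ih, rankOneDiff_smul]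

theorem topDiff_cubic (C : Matrix (Fin 3) (Fin 3) K) (c e : K) :
    topDiff (fun X : Matrix (Fin 3) (Fin 3) K => c * X.det + (C * X).trace + e) 0 = c := by
  have e1 : (fun X : Matrix (Fin 3) (Fin 3) K => c * X.det + (C * X).trace + e) =
      c • (fun X : Matrix (Fin 3) (Fin 3) K => (X + 0).det) + fun X => (C * X).trace + e := by
    ext X; simp [add_assoc]
  have e2 : topDiff (fun X : Matrix (Fin 3) (Fin 3) K => (C * X).trace + e) = 0 := by
    have : rankOneDiff (Pi.single 2 1) (Pi.single 2 1)
        (fun X : Matrix (Fin 3) (Fin 3) K => (C * X).trace + e) =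
        fun _ => (C * vecMulVec (Pi.single 2 1) (Pi.single 2 1)).trace := by
      ext X; simp [rankOneDiff, Matrix.mul_add]
    change rankOneDiff (Pi.single 0 1) (Pi.single 0 1) (rankOneDiff (Pi.single 1 1) (Pi.single 1 1)
      (rankOneDiff (Pi.single 2 1) (Pi.single 2 1) fun X => (C * X).trace + e)) = 0
    rw [this, rankOneDiff_const, rankOneDiff_zero]
  have e3 := topDiff_det (0 : Matrix (Fin 3) (Fin 3) K) 0
  rw [e1]
  unfold topDiff at e2 e3 ⊢
  rw [iterDiff_add, iterDiff_smul, e2, add_zero, Pi.smul_apply, e3, smul_eq_mul, mul_one]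

/-- The lower right `2 × 2` block of `C` is zero or nonsingular. In the function `tr (C X)` this
block holds the coefficients of the lower right block of `X`. -/
def BlockGood (C : Matrix (Fin 3) (Fin 3) K) : Prop :=
  (C 1 1 = 0 ∧ C 1 2 = 0 ∧ C 2 1 = 0 ∧ C 2 2 = 0) ∨ C 1 1 * C 2 2 - C 1 2 * C 2 1 ≠ 0

/-- The adjoint action `C ↦ P* C P` on coefficient matrices. -/
def coCongruence (σ : K →+* K) (P C : Matrix (Fin 3) (Fin 3) K) : Matrix (Fin 3) (Fin 3) K :=
  Pᵀ.map σ * C * P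

theorem coCongruence_mul (P R C : Matrix (Fin 3) (Fin 3) K) :
    coCongruence σ R (coCongruence σ P C) = coCongruence σ (P * R) C := by
  simp only [coCongruence, Matrix.transpose_mul, Matrix.map_mul, Matrix.mul_assoc]

theorem coCongruence_perm (π : Equiv.Perm (Fin 3)) (C : Matrix (Fin 3) (Fin 3) K) :
    coCongruence σ ((1 : Matrix (Fin 3) (Fin 3) K).submatrix id π) C = C.submatrix π π := by
  have e : ((1 : Matrix (Fin 3) (Fin 3) K).submatrix id π)ᵀ.map σ =
      (1 : Matrix (Fin 3) (Fin 3) K).submatrix π id := by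
    ext i j
    simp only [Matrix.map_apply, Matrix.transpose_apply, Matrix.submatrix_apply, id_eq,
      Matrix.one_apply]
    by_cases hij : j = π i
    · simp [hij]
    · simp [hij, Ne.symm hij]
  rw [coCongruence, e]
  ext i j
  simp [Matrix.mul_apply, Matrix.one_apply]

theorem isUnit_perm (π : Equiv.Perm (Fin 3)) :
    IsUnit ((1 : Matrix (Fin 3) (Fin 3) K).submatrix id π) := by
  refine isUnit_iff_exists.2 ⟨(1 : Matrix (Fin 3) (Fin 3) K).submatrix π id, ?_, ?_⟩
  · ext i j
    simp only [Matrix.mul_apply, Matrix.submatrix_apply, id_eq, Matrix.one_apply, mul_ite, mul_one,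
      mul_zero]
    rw [← Equiv.sum_comp π.symm]
    simp [eq_comm]
  · ext i j
    simp [Matrix.mul_apply, Matrix.one_apply]

/-- The coefficient matrix of the linear part can be brought into one of the two shapes of
`BlockGood` by a congruence. -/
theorem exists_blockGood {C : Matrix (Fin 3) (Fin 3) K} (hC : IsHerm σ C) :
    ∃ P, IsUnit P ∧ BlockGood (coCongruence σ P C) := by
  have hnorm : ∀ x : K, x * σ x = 0 → x = 0 := by
    intro x hx
    rcases mul_eq_zero.1 hx with hx | hx
    · exact hx
    · exact (map_eq_zero σ).1 hx
  by_cases ha : ∃ i j, i ≠ j ∧ C i i * C j j - C i j * C j i ≠ 0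
  · -- a nonsingular principal block is moved to the last two coordinates
    obtain ⟨i, j, hij, hne⟩ := ha
    have hperm : ∀ i j : Fin 3, i ≠ j → ∃ π : Equiv.Perm (Fin 3), π 1 = i ∧ π 2 = j := by decide
    obtain ⟨π, h1, h2⟩ := hperm i j hij
    refine ⟨_, isUnit_perm π, Or.inr ?_⟩
    rw [coCongruence_perm]
    simpa [h1, h2] using hne
  · push Not at ha
    by_cases hb : ∃ k, C k k ≠ 0
    · obtain ⟨k, hk⟩ := hb
      set π : Equiv.Perm (Fin 3) := Equiv.swap 0 k with hπ
      set D := C.submatrix π π with hD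
      have hDh : ∀ i j, σ (D j i) = D i j := fun i j => hC _ _
      have hD0 : D 0 0 ≠ 0 := by simpa [hD, hπ] using hk
      have hDa : ∀ i j, i ≠ j → D i i * D j j - D i j * D j i = 0 := fun i j hij =>
        ha _ _ fun e => hij (π.injective e)
      -- clear the first row and column: the diagonal of the Schur complement vanishes
      let R : Matrix (Fin 3) (Fin 3) K :=
        !![1, -(D 0 1 / D 0 0), -(D 0 2 / D 0 0); 0, 1, 0; 0, 0, 1]
      have hR : IsUnit R := by
        rw [Matrix.isUnit_iff_isUnit_det]
        simp [R, det_fin_three]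
      refine ⟨_ * R, (isUnit_perm π).mul hR, ?_⟩
      rw [← coCongruence_mul, coCongruence_perm, ← hD]
      have hval : ∀ i j : Fin 3, i ≠ 0 → j ≠ 0 →
          coCongruence σ R D i j = D i j - D i 0 * D 0 j / D 0 0 := by
        have s01 := hDh 1 0
        have s02 := hDh 2 0
        have s00 := hDh 0 0
        intro i j hi hj
        fin_cases i <;> fin_cases j <;> simp at hi hj <;>
          simp [coCongruence, Matrix.mul_apply, Fin.sum_univ_three, R, s01, s02, s00] <;>
          field_simp <;> ring
      have h11 : coCongruence σ R D 1 1 = 0 := by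
        rw [hval 1 1 (by decide) (by decide)]
        have := hDa 0 1 (by decide)
        field_simp
        linear_combination this
      have h22 : coCongruence σ R D 2 2 = 0 := by
        rw [hval 2 2 (by decide) (by decide)]
        have := hDa 0 2 (by decide)
        field_simp
        linear_combination this
      have h21 : coCongruence σ R D 2 1 = σ (coCongruence σ R D 1 2) := by
        rw [hval 1 2 (by decide) (by decide), hval 2 1 (by decide) (by decide)]
        simp only [map_sub, map_div₀, map_mul, hDh]
        ring
      by_cases hz : coCongruence σ R D 1 2 = 0
      · exact Or.inl ⟨h11, hz, by rw [h21, hz, map_zero], h22⟩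
      · refine Or.inr fun hcon => hz (hnorm _ ?_)
        rw [h11, h21] at hcon
        linear_combination -hcon
    · push Not at hb
      refine ⟨1, isUnit_one, Or.inl ?_⟩
      have hz : ∀ i j, C i j = 0 := by
        intro i j
        by_cases hij : i = j
        · rw [hij, hb]
        · have := ha i j hij
          rw [hb, zero_mul, zero_sub, neg_eq_zero, ← hC j i] at this
          exact hnorm _ this
      simp [coCongruence, hz]

variable [Fintype K] {q : ℕ}

theorem HermFun.second_diff_symm (h : QuadConj q σ) {n : ℕ} {f : Matrix (Fin n) (Fin n) K → K}
    (hf : HermFun σ f) (i j k m : Fin n) :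
    rankOneDiff (Pi.single i 1) (Pi.single j 1) (rankOneDiff (Pi.single k 1) (Pi.single m 1) f) 0 =
      σ (rankOneDiff (Pi.single j 1) (Pi.single i 1)
        (rankOneDiff (Pi.single m 1) (Pi.single k 1) f) 0) := by
  have h1 := hf.diff_symm h (Pi.single k 1) (Pi.single m 1) 0
  have h2 := hf.diff_symm h (Pi.single k 1) (Pi.single m 1)
    (0 + vecMulVec (Pi.single j 1) (Pi.single i 1))
  have e1 : (0 + vecMulVec (Pi.single j 1) (Pi.single i 1) : Matrix (Fin n) (Fin n) K)ᵀ.map σ =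
      0 + vecMulVec (Pi.single i 1) (Pi.single j 1) := by
    ext a b
    simp only [zero_add, Matrix.map_apply, Matrix.transpose_apply, vecMulVec_apply, map_mul]
    rw [mul_comm]
    congr 1
    · exact congrFun (comp_single (σ := σ) i) a
    · exact congrFun (comp_single (σ := σ) j) b
  rw [isHerm_zero.map_eq, comp_single, comp_single] at h1
  rw [e1, comp_single, comp_single] at h2
  rw [rankOneDiff, h1, h2, ← map_sub]
  rfl

theorem HermFun.topDiff_fixed (h : QuadConj q σ) {n : ℕ} {f : Matrix (Fin n) (Fin n) K → K}
    (hf : HermFun σ f) : σ (topDiff f 0) = topDiff f 0 :=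
  (hf.iterate h _ fun p hp => by
    obtain ⟨i, _, rfl⟩ := List.mem_map.1 hp
    exact (comp_single i).symm : HermFun σ (topDiff f)).fixed isHerm_zero

/-- In dimension three, a translation removes the `2 × 2` minors from a function in which the
determinant occurs. -/
theorem HermFun.dim_three_normal_form (h : QuadConj q σ) {f : Matrix (Fin 3) (Fin 3) K → K}
    (hf : HermFun σ f) (h0 : topDiff f ≠ 0) : ∃ T C : Matrix (Fin 3) (Fin 3) K,
      IsHerm σ T ∧ IsHerm σ C ∧ ∃ c ≠ 0, ∃ e, ∀ X, f (X + T) = c * X.det + (C * X).trace + e := by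
  set c := topDiff f 0 with hc
  have hc0 : c ≠ 0 := by
    intro hz; apply h0; ext X; rw [hf.affine.topDiff_const X 0, ← hc, hz]; rfl
  have hcσ : σ c = c := hf.topDiff_fixed h
  let T : Matrix (Fin 3) (Fin 3) K := Matrix.of fun r s => minorDiff f r s 0 / c
  have hT : IsHerm σ T := by
    intro r s
    simp only [T, Matrix.of_apply, map_div₀, hcσ]
    rw [minorDiff, minorDiff, hf.second_diff_symm h (r + 1)]
  let g : Matrix (Fin 3) (Fin 3) K → K := f - c • fun X => (X + T).det
  have hg : HermFun σ g := by
    refine ⟨hf.affine.sub ((RankOneAffine.det.comp_add T).smul c), fun X => ?_⟩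
    have : Xᵀ.map σ + T = (X + T)ᵀ.map σ := by
      ext i j
      simp [hT i j]
    simp only [g, Pi.sub_apply, Pi.smul_apply, smul_eq_mul, hf.symm, map_sub, map_mul, hcσ, this]
    rw [← RingHom.mapMatrix_apply, ← RingHom.map_det, det_transpose]
  have hg0 : topDiff g = 0 := by
    ext X
    simp only [g, topDiff, sub_eq_add_neg]
    rw [← neg_one_smul K, smul_smul, iterDiff_add, iterDiff_smul]
    have h1 := topDiff_det T X
    have h2 := hf.affine.topDiff_const X 0
    unfold topDiff at h1 h2 hc
    simp [h1, h2, ← hc]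
  have hgm : ∀ r s, minorDiff g r s 0 = 0 := by
    intro r s
    have h1 : minorDiff g r s 0 =
        minorDiff f r s 0 - c * minorDiff (fun X => (X + T).det) r s 0 := by
      simp only [g, minorDiff, rankOneDiff_sub, rankOneDiff_smul]
      rfl
    have h2 : c * T r s = minorDiff f r s 0 := by
      simp only [T, Matrix.of_apply]
      field_simp
    rw [h1, minorDiff_det, h2, sub_self]
  let C : Matrix (Fin 3) (Fin 3) K := Matrix.of fun j i =>
    rankOneDiff (Pi.single i 1) (Pi.single j 1) g 0
  have hC : IsHerm σ C := by
    intro i j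
    have := hg.diff_symm h (Pi.single j 1) (Pi.single i 1) 0
    rw [isHerm_zero.map_eq, comp_single, comp_single] at this
    exact this.symm
  have hgX : ∀ X, g X = g 0 + (C * X).trace := by
    intro X
    rw [hg.affine.eq_affine (hg.affine.second_diff_eq_zero hg0 hgm) X]
    congr 1
    simp only [Matrix.trace, Matrix.diag_apply, Matrix.mul_apply, C, Matrix.of_apply]
    rw [Finset.sum_comm]
    simp only [mul_comm]
  refine ⟨-T, C, ?_, hC, c, hc0, g 0 - (C * T).trace, fun X => ?_⟩
  · intro i j
    simp [hT i j]
  · have h1 := hgX (X + -T)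
    simp only [g, Pi.sub_apply, Pi.smul_apply, smul_eq_mul, neg_add_cancel_right] at h1
    have h2 : (C * (X + -T)).trace = (C * X).trace - (C * T).trace := by
      rw [Matrix.mul_add, Matrix.mul_neg, trace_add, trace_neg, sub_eq_add_neg]
    rw [h2] at h1
    simp only [g, Pi.sub_apply, Pi.smul_apply, smul_eq_mul]
    linear_combination h1

/-- For a cubic in normal form only the restriction to the zero column can vanish identically: the
vanishing of the restriction to the column `v` forces the lower right block of `C` to have
determinant zero, so to be zero, and then `v = 0`. -/
theorem HermFun.hermZeros_cubic_le [DecidableEq K] (h : QuadConj q σ)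
    {f : Matrix (Fin 3) (Fin 3) K → K}
    (hf : HermFun σ f) {C : Matrix (Fin 3) (Fin 3) K} (hC : BlockGood C) {c e : K} (hc : c ≠ 0)
    (hfX : ∀ X, f X = c * X.det + (C * X).trace + e) :
    (hermZeros σ f : ℝ) ≤ q ^ 8 + q ^ 6 - q ^ 5 + q ^ 4 - q ^ 3 := by
  have h0 : topDiff f ≠ 0 := by
    intro hz
    have := topDiff_cubic C c e
    rw [← funext hfX, hz] at this
    exact hc this.symm
  have hq : (2 : ℝ) ≤ q := by exact_mod_cast h.two_le
  obtain ⟨c', hc', a₀, ha₀, htop⟩ := hf.exists_topDiff_bordered h h0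
  have := hermZeros_le_of_corner h (f := f) ha₀ (B := q ^ 3 + q) (B' := q ^ 3) (s := 1) ?_ ?_ ?_ ?_
  · refine this.trans (le_of_eq ?_)
    push_cast
    ring
  · intro a v hσ ha
    have hne : topDiff (f ∘ bordered σ a v) ≠ 0 := by
      intro hz
      have := htop a v 0
      rw [hz] at this
      exact mul_ne_zero hc' (sub_ne_zero.2 ha) this.symm
    exact (hf.comp_bordered h hσ v).hermZeros_dim_two_of_topDiff_ne h hne
  · intro v hv
    refine (hf.comp_bordered h ha₀ v).hermZeros_dim_two_of_topDiff_eq h ?_ hv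
    ext M; rw [htop, sub_self, mul_zero]; rfl
  · exact pow_le_pow_right₀ (by linarith) (by norm_num)
  · intro S hS
    have hv0 : ∀ v ∈ S, v = 0 := by
      intro v hv
      have hM : ∀ m00 m01 m10 m11 : K,
          c * (a₀ * m00 * m11 - a₀ * m01 * m10 - σ (v 0) * v 0 * m11 + σ (v 0) * m01 * v 1
            + σ (v 1) * v 0 * m10 - σ (v 1) * m00 * v 1) + (C 0 0 * a₀ + C 0 1 * v 0 + C 0 2 * v 1
            + (C 1 0 * σ (v 0) + C 1 1 * m00 + C 1 2 * m10)
            + (C 2 0 * σ (v 1) + C 2 1 * m01 + C 2 2 * m11)) + e = 0 := by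
        intro m00 m01 m10 m11
        have := congrFun (hS v hv) !![m00, m01; m10, m11]
        rw [Function.comp_apply, hfX, det_fin_three] at this
        simp only [Matrix.trace, Matrix.diag_apply, Matrix.mul_apply, Fin.sum_univ_three] at this
        exact this
      -- the coefficients of the four free entries express the block through `v`
      have g0 := hM 0 0 0 0
      have g1 := hM 1 0 0 0
      have g2 := hM 0 0 0 1
      have g3 := hM 0 1 0 0
      have g4 := hM 0 0 1 0
      have k1 : C 1 1 = c * (σ (v 1) * v 1) := by linear_combination g1 - g0
      have k2 : C 2 2 = c * (σ (v 0) * v 0) := by linear_combination g2 - g0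
      have k3 : C 2 1 = -c * (σ (v 0) * v 1) := by linear_combination g3 - g0
      have k4 : C 1 2 = -c * (σ (v 1) * v 0) := by linear_combination g4 - g0
      have hz : ∀ x : K, c * (σ x * x) = 0 → x = 0 := by
        intro x hx
        rcases mul_eq_zero.1 ((mul_eq_zero.1 hx).resolve_left hc) with hx | hx
        · exact (map_eq_zero σ).1 hx
        · exact hx
      rcases hC with ⟨z1, _, _, z2⟩ | hne
      · rw [z1] at k1
        rw [z2] at k2
        ext i
        fin_cases i
        · exact hz _ k2.symm
        · exact hz _ k1.symm
      · exfalso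
        apply hne
        rw [k1, k2, k3, k4]
        ring
    exact Finset.card_le_one.2 fun v hv w hw => (hv0 v hv).trans (hv0 w hw).symm

/-- The bound in dimension three: after a translation and a congruence at most one restriction to
a prescribed first row and column vanishes. -/
theorem HermFun.hermZeros_dim_three_of_topDiff_ne [DecidableEq K] (h : QuadConj q σ)
    {f : Matrix (Fin 3) (Fin 3) K → K} (hf : HermFun σ f) (h0 : topDiff f ≠ 0) :
    (hermZeros σ f : ℝ) ≤ q ^ 8 + q ^ 6 - q ^ 5 + q ^ 4 - q ^ 3 := by
  obtain ⟨T, C, hT, hC, c, hc, e, hfX⟩ := hf.dim_three_normal_form h h0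
  obtain ⟨P, hP, hgood⟩ := exists_blockGood hC
  let f₁ : Matrix (Fin 3) (Fin 3) K → K := fun X => f (X + T)
  have hf₁ : HermFun σ f₁ := by
    refine ⟨hf.affine.comp_add T, fun X => ?_⟩
    have : Xᵀ.map σ + T = (X + T)ᵀ.map σ := by
      ext i j
      simp [hT i j]
    simp only [f₁, this, hf.symm]
  have h1 : hermZeros σ f ≤ hermZeros σ f₁ := by
    refine hermZeros_mono (fun X => X - T) (fun X Y hXY => sub_left_injective hXY) fun X hX hz => ?_
    refine ⟨fun i j => ?_, ?_⟩
    · simp [hX i j, hT i j]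
    · simpa [f₁] using hz
  have h2 : P.det ≠ 0 := by
    rw [Matrix.isUnit_iff_isUnit_det] at hP
    exact hP.ne_zero
  have h3 := (hf₁.comp_congruence h P).hermZeros_cubic_le h hgood (c := c * (P.det * σ P.det))
    (e := e) (mul_ne_zero hc (mul_ne_zero h2 (by simpa using h2))) (fun X => by
      simp only [Function.comp_apply, f₁, hfX, congruence, coCongruence, det_mul]
      congr 2
      · have : (Pᵀ.map σ).det = σ P.det := by
          rw [← RingHom.mapMatrix_apply, ← RingHom.map_det, det_transpose]
        rw [this]
        ring
      · rw [← Matrix.mul_assoc, trace_mul_comm]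
        simp only [Matrix.mul_assoc])
  rw [hermZeros_comp_congruence h f₁ hP] at h3
  exact le_trans (by exact_mod_cast h1) h3

end

/-! ### The bound in all dimensions -/

section

variable {K : Type*} [Field K] [Fintype K] [DecidableEq K] {σ : K →+* K} {q : ℕ}

/-- One step of the induction for functions in which the determinant occurs. The gain
`(q ^ 2 - q + 1) / q ^ (2 * n)` over the general bound pays for the at most `q + 1` restrictions
that vanish identically. -/
theorem hermZeros_topDiff_step (h : QuadConj q σ) {n : ℕ}
    (hgen : ∀ f : Matrix (Fin n) (Fin n) K → K, HermFun σ f → f ≠ 0 →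
      (hermZeros σ f : ℝ) ≤ q ^ n ^ 2 * (1 / q + 1 / q ^ 3))
    (htop : ∀ f : Matrix (Fin n) (Fin n) K → K, HermFun σ f → topDiff f ≠ 0 →
      (hermZeros σ f : ℝ) ≤ q ^ n ^ 2 * (1 / q + 1 / q ^ 3 - (q ^ 2 - q + 1) / q ^ (2 * n)))
    {f : Matrix (Fin (n + 1)) (Fin (n + 1)) K → K} (hf : HermFun σ f) (h0 : topDiff f ≠ 0) :
    (hermZeros σ f : ℝ) ≤ q ^ (n + 1) ^ 2 *
      (1 / q + 1 / q ^ 3 - (q ^ 2 - q + 1) / q ^ (2 * (n + 1))) := by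
  obtain ⟨c, hc, a₀, ha₀, hval⟩ := hf.exists_topDiff_bordered h h0
  have hq : (2 : ℝ) ≤ q := by exact_mod_cast h.two_le
  have hq0 : (0 : ℝ) < q := by linarith
  have hbound := hermZeros_le_of_corner h (f := f) ha₀
    (fun a v hσ ha => htop _ (hf.comp_bordered h hσ v) (fun hz => by
      have := hval a v 0
      rw [hz] at this
      exact mul_ne_zero hc (sub_ne_zero.2 ha) this.symm))
    (fun v hv => hgen _ (hf.comp_bordered h ha₀ v) hv)
    (by
      have h1 : 1 / (q : ℝ) + 1 / q ^ 3 ≤ 1 := by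
        rw [div_add_div _ _ (by positivity) (by positivity), div_le_one (by positivity)]
        nlinarith [pow_pos hq0 3, mul_le_mul_of_nonneg_left hq (pow_pos hq0 3).le,
          mul_le_mul_of_nonneg_left hq (pow_pos hq0 2).le]
      exact mul_le_of_le_one_right (by positivity) h1)
    (fun S hS => hf.card_bordered_eq_zero_le h h0 ha₀ S hS)
  refine hbound.trans ?_
  have e1 : (q : ℝ) ^ (n + 1) ^ 2 = q ^ n ^ 2 * q ^ (2 * n) * q := by
    rw [← pow_add, ← pow_succ]; congr 1; ring
  have e2 : (q : ℝ) ^ (2 * (n + 1)) = q ^ (2 * n) * q ^ 2 := by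
    rw [← pow_add]; congr 1
  rw [e1, e2]
  set N : ℝ := q ^ n ^ 2 with hN
  set Q : ℝ := q ^ (2 * n) with hQ
  have hNpos : 0 < N := by positivity
  have hQpos : 0 < Q := by positivity
  rw [← sub_nonneg]
  have key : N * Q * q * (1 / q + 1 / q ^ 3 - (q ^ 2 - q + 1) / (Q * q ^ 2)) -
      ((q - 1) * Q * (N * (1 / q + 1 / q ^ 3 - (q ^ 2 - q + 1) / Q)) +
        Q * (N * (1 / q + 1 / q ^ 3)) +
        ((q + 1 : ℕ) : ℝ) * (N - N * (1 / q + 1 / q ^ 3))) =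
      N / q ^ 3 * (q ^ 5 * (q - 2) + q + 1) := by
    push_cast
    field_simp
    ring
  rw [key]
  have : (0 : ℝ) ≤ q - 2 := by linarith
  positivity

/-- The bound on the number of Hermitian zeros, proved together with its sharper form for functions
in which the determinant occurs. The sharper form fails in dimensions one and two; in dimension
three it holds because only one restriction, instead of `q + 1`, vanishes identically. -/
theorem hermZeros_bounds (h : QuadConj q σ) (n : ℕ) :
    (∀ f : Matrix (Fin n) (Fin n) K → K, HermFun σ f → f ≠ 0 →
      (hermZeros σ f : ℝ) ≤ q ^ n ^ 2 * (1 / q + 1 / q ^ 3)) ∧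
    (3 ≤ n → ∀ f : Matrix (Fin n) (Fin n) K → K, HermFun σ f → topDiff f ≠ 0 →
      (hermZeros σ f : ℝ) ≤ q ^ n ^ 2 * (1 / q + 1 / q ^ 3 - (q ^ 2 - q + 1) / q ^ (2 * n))) := by
  have hq : (2 : ℝ) ≤ q := by exact_mod_cast h.two_le
  have hq0 : (0 : ℝ) < q := by linarith
  induction n with
  | zero =>
    refine ⟨fun f _ hne => ?_, fun h3 => by omega⟩
    rw [hermZeros_dim_zero hne, Nat.cast_zero]
    positivity
  | succ n ih =>
    obtain ⟨hgen, htop⟩ := ih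
    have htop' : 3 ≤ n + 1 → ∀ f : Matrix (Fin (n + 1)) (Fin (n + 1)) K → K, HermFun σ f →
        topDiff f ≠ 0 → (hermZeros σ f : ℝ) ≤
          q ^ (n + 1) ^ 2 * (1 / q + 1 / q ^ 3 - (q ^ 2 - q + 1) / q ^ (2 * (n + 1))) := by
      intro hn f hf h0
      rcases Nat.lt_or_ge n 3 with hlt | hge
      · obtain rfl : n = 2 := by omega
        refine (hf.hermZeros_dim_three_of_topDiff_ne h h0).trans (le_of_eq ?_)
        norm_num
        field_simp
        ring
      · exact hermZeros_topDiff_step h hgen (htop hge) hf h0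
    refine ⟨fun f hf hne => ?_, htop'⟩
    obtain ⟨P, hP, hcase⟩ := hf.dichotomy h hne
    rw [← hermZeros_comp_congruence h f hP]
    have hfP := hf.comp_congruence h P
    set g := f ∘ congruence σ P
    rcases hcase with h0 | hfib
    · rcases Nat.lt_or_ge n 2 with hlt | hge
      · interval_cases n
        · have h1 : (hermZeros σ g : ℝ) ≤ 1 := by
            exact_mod_cast hfP.hermZeros_dim_one_of_topDiff_ne h h0
          refine h1.trans ?_
          have : (q : ℝ) ^ (0 + 1) ^ 2 * (1 / q + 1 / q ^ 3) = 1 + 1 / q ^ 2 := by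
            field_simp
            ring
          rw [this]
          have : (0 : ℝ) < 1 / q ^ 2 := by positivity
          linarith
        · refine (hfP.hermZeros_dim_two_of_topDiff_ne h h0).trans (le_of_eq ?_)
          norm_num
          field_simp
      · refine (htop' (by omega) g hfP h0).trans ?_
        refine mul_le_mul_of_nonneg_left ?_ (by positivity)
        have h1 : (0 : ℝ) < q ^ 2 - q + 1 := by nlinarith
        have : 0 ≤ ((q : ℝ) ^ 2 - q + 1) / q ^ (2 * (n + 1)) := by positivity
        linarith
    · refine (hermZeros_le_of_fibres h fun a v ha =>
        hgen _ (hfP.comp_bordered h ha v) (hfib a v)).trans (le_of_eq ?_)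
      have e1 : (q : ℝ) ^ (n + 1) ^ 2 = q * q ^ (2 * n) * q ^ n ^ 2 := by
        rw [← pow_succ', ← pow_add]; congr 1; ring
      rw [e1]
      ring

end

/-! ### Codewords as real functions, and the zeros of the leading minor -/

theorem sum_apply_zero {α : Type*} [Fintype α] (g : α → ℕ) (m : ℕ) :
    ∑ v : Fin (m + 1) → α, g (v 0) = Fintype.card α ^ m * ∑ t, g t := by
  rw [← (Fin.consEquiv fun _ : Fin (m + 1) => α).sum_comp, Fintype.sum_prod_type]
  simp [Fin.consEquiv, Finset.mul_sum]

section

variable {K : Type*} [Field K] [Fintype K] {n : ℕ} {σ : K →+* K} {q : ℕ}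

/-- A field with `q ^ 2` elements, `q` a prime power, has the conjugation `x ↦ x ^ q`. -/
theorem exists_quadConj (hq : IsPrimePow q) (hK : Fintype.card K = q ^ 2) :
    ∃ σ : K →+* K, QuadConj q σ := by
  obtain ⟨p, k, hp, hk, rfl⟩ := hq
  have hp' : p.Prime := hp.nat_prime
  have : Fact p.Prime := ⟨hp'⟩
  have hchar : CharP K p := by
    obtain ⟨c, hc⟩ := CharP.exists K
    have hcp := (CharP.char_is_prime K c)
    obtain ⟨m, -, hm⟩ := FiniteField.card K c
    have : p ∣ c ^ (m : ℕ) := by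
      rw [← hm, hK, ← pow_mul]
      exact dvd_pow_self p (by omega)
    rwa [(Nat.prime_dvd_prime_iff_eq hp' hcp).1 (hp'.dvd_of_dvd_pow this)]
  exact ⟨iterateFrobenius K p k, Nat.one_lt_pow hk.ne' hp'.one_lt, hK,
    fun x => iterateFrobenius_def p k x⟩

theorem RankOneAffine.star (h : QuadConj q σ) {f : Matrix (Fin n) (Fin n) K → K}
    (hf : RankOneAffine f) : RankOneAffine fun X => σ (f (Xᵀ.map σ)) := by
  have e : ∀ u v, rankOneDiff u v (fun X => σ (f (Xᵀ.map σ))) =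
      fun X => σ (rankOneDiff (σ ∘ v) (σ ∘ u) f (Xᵀ.map σ)) := by
    intro u v
    ext X
    have : (X + vecMulVec u v)ᵀ.map σ = Xᵀ.map σ + vecMulVec (σ ∘ v) (σ ∘ u) := by
      ext i j; simp [vecMulVec_apply, mul_comm]
    simp only [rankOneDiff, this, map_sub]
  have hadd : ∀ u v : Fin n → K, σ ∘ (u + v) = σ ∘ u + σ ∘ v := fun u v => by
    ext i; simp
  have hsmul : ∀ (c : K) (v : Fin n → K), σ ∘ (c • v) = σ c • (σ ∘ v) := fun c v => by
    ext i; simp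
  constructor <;> intros <;> ext X <;>
    simp [e, hadd, hsmul, hf.add_left, hf.add_right, hf.smul_left, hf.smul_right, h.invol]

/-- Replacing `f` by `θ f + (θ f)*`, where `g*` is `X ↦ σ (g (X*))`, makes its values on Hermitian
matrices fixed by the conjugation and does not lose Hermitian zeros; a suitable `θ` keeps the value
at `P` nonzero. -/
theorem RankOneAffine.exists_hermFun (h : QuadConj q σ) {f : Matrix (Fin n) (Fin n) K → K}
    (hf : RankOneAffine f) {P : Matrix (Fin n) (Fin n) K} (hP : IsHerm σ P) (hfP : f P ≠ 0) :
    ∃ g : Matrix (Fin n) (Fin n) K → K, HermFun σ g ∧ g ≠ 0 ∧ hermZeros σ f ≤ hermZeros σ g := by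
  obtain ⟨θ, hθ⟩ : ∃ θ, σ (f P) * σ θ + f P * θ ≠ 0 := by
    by_contra! H
    exact hfP (h.eq_zero_of_linear H).2
  refine ⟨fun X => θ * f X + σ (θ * f (Xᵀ.map σ)), ⟨(hf.smul θ).add ((hf.smul θ).star h),
    fun X => ?_⟩, fun h0 => hθ ?_, hermZeros_mono id Function.injective_id fun X hX h0 => ?_⟩
  · have : (Xᵀ.map σ)ᵀ.map σ = X := by ext i j; simp [h.invol]
    simp only [this, map_add, h.invol]
    ring
  · have := congrFun h0 P
    simp only [hP.map_eq, map_mul, Pi.zero_apply] at this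
    linear_combination this
  · exact ⟨hX, by simp [hX.map_eq, h0]⟩

variable [DecidableEq K]

theorem RankOneAffine.hermZeros_le (h : QuadConj q σ) (hn : 2 ≤ n)
    {f : Matrix (Fin n) (Fin n) K → K} (hf : RankOneAffine f) {P : Matrix (Fin n) (Fin n) K}
    (hP : IsHerm σ P) (hfP : f P ≠ 0) :
    hermZeros σ f ≤ q ^ (n ^ 2 - 1) + q ^ (n ^ 2 - 3) := by
  obtain ⟨g, hg, hg0, hle⟩ := hf.exists_hermFun h hP hfP
  have hb := (hermZeros_bounds h n).1 g hg hg0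
  refine hle.trans ?_
  have hq : (q : ℝ) ≠ 0 := by
    have := h.two_le
    positivity
  obtain ⟨k, hk⟩ : ∃ k, n ^ 2 = k + 3 :=
    ⟨n ^ 2 - 3, (Nat.sub_add_cancel (show 3 ≤ n ^ 2 by nlinarith)).symm⟩
  rw [hk] at hb ⊢
  have e : (q : ℝ) ^ (k + 3) * (1 / q + 1 / q ^ 3) = q ^ (k + 3 - 1) + q ^ (k + 3 - 3) := by
    simp only [Nat.add_sub_cancel, show k + 3 - 1 = k + 2 by omega]
    field_simp
    ring
  rw [e] at hb
  exact_mod_cast hb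

/-- The number of Hermitian matrices with corner `c / a`. -/
theorem hermZeros_corner (h : QuadConj q σ) (m : ℕ) {a c : K} (ha : a ≠ 0) (hσa : σ a = a)
    (hσc : σ c = c) : hermZeros σ (fun M : Matrix (Fin (m + 1)) (Fin (m + 1)) K => a * M 0 0 - c) =
      q ^ (2 * m) * q ^ m ^ 2 := by
  rw [hermZeros_eq_sum h, Finset.sum_eq_single (⟨c / a, by simp [hσa, hσc]⟩ : FixedBy σ)]
  · have : ∀ v : Fin m → K, ((fun M : Matrix (Fin (m + 1)) (Fin (m + 1)) K => a * M 0 0 - c) ∘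
        bordered σ (c / a) v) = 0 := by
      intro v
      ext M
      simp [mul_div_cancel₀ _ ha]
    simp only [this, hermZeros_zero h]
    simp [h.card, pow_mul]
  · intro b _ hb
    refine Finset.sum_eq_zero fun v _ => hermZeros_eq_zero_of_ne fun M h0 => hb ?_
    ext
    simp only [Function.comp_apply, bordered_zero_zero] at h0
    rw [eq_div_iff ha]
    linear_combination h0
  · simp

/-- The number of Hermitian zeros of the leading `2 × 2` minor plus one: split according to the
corner entry `a`, which is zero or one of `q - 1` others. -/
theorem hermZeros_leading_minor (h : QuadConj q σ) (m : ℕ) :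
    hermZeros σ (fun X : Matrix (Fin (m + 2)) (Fin (m + 2)) K =>
      X 0 0 * X 1 1 - X 0 1 * X 1 0 + 1) = q ^ ((m + 2) ^ 2 - 1) + q ^ ((m + 2) ^ 2 - 3) := by
  have e : ∀ (a : K) (v : Fin (m + 1) → K), ((fun X : Matrix (Fin (m + 2)) (Fin (m + 2)) K =>
      X 0 0 * X 1 1 - X 0 1 * X 1 0 + 1) ∘ bordered σ a v) =
      fun M => a * M 0 0 - (v 0 * σ (v 0) - 1) := by
    intro a v
    ext M
    change a * M 0 0 - σ (v 0) * v 0 + 1 = _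
    ring
  have hne : ∀ a : FixedBy σ, a ≠ ⟨0, map_zero σ⟩ → ∀ v : Fin (m + 1) → K,
      hermZeros σ (fun M : Matrix (Fin (m + 1)) (Fin (m + 1)) K =>
        a.1 * M 0 0 - (v 0 * σ (v 0) - 1)) = q ^ (2 * m) * q ^ m ^ 2 := by
    intro a ha v
    refine hermZeros_corner h m (fun h0 => ha (Subtype.ext h0)) a.2 ?_
    simp [h.invol, mul_comm]
  have hzero : ∀ v : Fin (m + 1) → K,
      hermZeros σ (fun M : Matrix (Fin (m + 1)) (Fin (m + 1)) K =>
        0 * M 0 0 - (v 0 * σ (v 0) - 1)) =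
      (fun t : K => if t * σ t = 1 then q ^ (m + 1) ^ 2 else 0) (v 0) := by
    intro v
    dsimp only
    split_ifs with h1
    · rw [← hermZeros_zero h (m + 1)]
      congr 1
      ext M
      simp [h1]
    · refine hermZeros_eq_zero_of_ne fun M h0 => h1 ?_
      linear_combination -h0
  rw [hermZeros_eq_sum h]
  simp only [e]
  rw [← Finset.add_sum_erase _ _ (Finset.mem_univ (⟨0, map_zero σ⟩ : FixedBy σ)),
    Finset.sum_congr rfl fun a ha =>
      Finset.sum_congr rfl fun v _ => hne a (Finset.ne_of_mem_erase ha) v]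
  rw [Finset.sum_congr rfl fun v _ => hzero v,
    sum_apply_zero (fun t : K => if t * σ t = 1 then q ^ (m + 1) ^ 2 else 0) m,
    ← Finset.sum_filter, Finset.sum_const, h.card_norm_one, Finset.sum_const,
    Finset.card_erase_of_mem (Finset.mem_univ _), Finset.card_univ,
    h.card_fixed, Finset.sum_const, Finset.card_univ, Fintype.card_fun, h.card, Fintype.card_fin]
  obtain ⟨r, rfl⟩ : ∃ r, q = r + 1 := ⟨q - 1, by have := h.two_le; omega⟩
  rw [show (m + 2) ^ 2 - 1 = m ^ 2 + 4 * m + 3 by ring_nf; omega,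
    show (m + 2) ^ 2 - 3 = m ^ 2 + 4 * m + 1 by ring_nf; omega]
  simp only [smul_eq_mul, Nat.add_sub_cancel, ← pow_mul]
  ring

end

end RankOne

/-! ### The code -/

section

variable {K : Type*} [Field K] {l : ℕ}

theorem map_minorDet {R S : Type*} [CommRing R] [CommRing S] (φ : R →+* S)
    (M : Matrix (Fin l) (Fin l) R) (I J : Finset (Fin l)) (h : I.card = J.card) :
    φ (minorDet M I J h) = minorDet (M.map φ) I J h := by
  rw [minorDet, RingHom.map_det]
  rfl

theorem aeval_minorDet (X : Matrix (Fin l) (Fin l) K) (I J : Finset (Fin l))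
    (h : I.card = J.card) :
    MvPolynomial.aeval (fun ij : Fin l × Fin l => X ij.1 ij.2)
      (minorDet (Matrix.mvPolynomialX (Fin l) (Fin l) K) I J h) = minorDet X I J h := by
  refine (map_minorDet (MvPolynomial.aeval (R := K) fun ij : Fin l × Fin l =>
    X ij.1 ij.2).toRingHom _ I J h).trans ?_
  congr 1
  ext i j
  simp

/-- Linear combinations of minors are rank-one affine. -/
theorem rankOneAffine_of_mem_minorSpace {f : MvPolynomial (Fin l × Fin l) K}
    (hf : f ∈ minorSpace l K) : RankOneAffine fun X : Matrix (Fin l) (Fin l) K =>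
      MvPolynomial.aeval (fun ij : Fin l × Fin l => X ij.1 ij.2) f := by
  induction hf using Submodule.span_induction with
  | mem f hf =>
    obtain ⟨I, J, h, rfl⟩ := hf
    simp only [aeval_minorDet]
    exact RankOneAffine.minor _ _
  | zero => simpa only [map_zero] using RankOneAffine.const (0 : K)
  | add f g _ _ hf hg => simp only [map_add]; exact hf.add hg
  | smul c f _ hf => simp only [map_smul]; exact hf.smul c

/-- The constant `1` is the empty minor. -/
theorem minorDet_add_one_mem (I J : Finset (Fin l)) (h : I.card = J.card) :
    minorDet (Matrix.mvPolynomialX (Fin l) (Fin l) K) I J h + 1 ∈ minorSpace l K := by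
  refine Submodule.add_mem _ (Submodule.subset_span ⟨I, J, h, rfl⟩)
    (Submodule.subset_span ⟨∅, ∅, rfl, ?_⟩)
  have : IsEmpty (Fin (∅ : Finset (Fin l)).card) := by rw [Finset.card_empty]; infer_instance
  exact Matrix.det_isEmpty.symm

theorem minorDet_pair {R : Type*} [CommRing R] (M : Matrix (Fin l) (Fin l) R) {i j : Fin l}
    (hij : i < j) {I : Finset (Fin l)} (hI : I = {i, j}) :
    minorDet M I I rfl = M i i * M j j - M i j * M j i := by
  have h2 : I.card = 2 := by rw [hI, Finset.card_pair hij.ne]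
  have hf : (![i, j] : Fin 2 → Fin l) = I.orderEmbOfFin h2 := by
    refine Finset.orderEmbOfFin_unique h2 (fun x => ?_) ?_
    · subst hI
      fin_cases x <;> simp
    · intro x y hxy
      fin_cases x <;> fin_cases y <;> simp_all
  have key : ∀ k (hk : I.card = k), minorDet M I I rfl =
      (M.submatrix (I.orderEmbOfFin hk) (I.orderEmbOfFin hk)).det := by
    rintro _ rfl
    rfl
  rw [key 2 h2, ← hf, Matrix.det_fin_two]
  simp

variable [Fintype K] {q : ℕ} {σ : K →+* K}

theorem conjTranspose_eq_iff (h : QuadConj q σ) {M : Matrix (Fin l) (Fin l) K} :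
    conjTranspose q M = M ↔ IsHerm σ M := by
  simp only [IsHerm, h.apply, ← Matrix.ext_iff, conjTranspose, Matrix.of_apply]

/-- The weight of a codeword is the number of Hermitian matrices that are not zeros of it. -/
theorem hammingNorm_hermitianEval [DecidableEq K] (h : QuadConj q σ)
    (f : MvPolynomial (Fin l × Fin l) K) :
    hammingNorm (hermitianEval q l K f) + hermZeros σ (fun X : Matrix (Fin l) (Fin l) K =>
      MvPolynomial.aeval (fun ij : Fin l × Fin l => X ij.1 ij.2) f) = q ^ l ^ 2 := by
  have e1 : Fintype.card (HermitianMatrix q l K) = q ^ l ^ 2 := by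
    rw [← hermZeros_zero h l, hermZeros, ← Nat.card_eq_fintype_card]
    exact Nat.card_congr (Equiv.subtypeEquivRight fun M => by simp [conjTranspose_eq_iff h])
  have e2 : hermZeros σ (fun X : Matrix (Fin l) (Fin l) K =>
      MvPolynomial.aeval (fun ij : Fin l × Fin l => X ij.1 ij.2) f) =
      (Finset.univ.filter fun P : HermitianMatrix q l K => hermitianEval q l K f P = 0).card := by
    rw [hermZeros, ← Fintype.card_subtype, ← Nat.card_eq_fintype_card]
    refine Nat.card_congr (Equiv.trans (Equiv.subtypeEquivRight fun M => ?_)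
      (Equiv.subtypeSubtypeEquivSubtypeInter (fun M => conjTranspose q M = M) (fun M =>
        MvPolynomial.aeval (fun ij : Fin l × Fin l => M ij.1 ij.2) f = 0)).symm)
    rw [conjTranspose_eq_iff h]
  rw [e2, hammingNorm, add_comm, ← e1, ← Finset.card_univ]
  exact Finset.card_filter_add_card_filter_not _

theorem hammingNorm_ge_of_mem_code [DecidableEq K] (h : QuadConj q σ) (hl : 2 ≤ l)
    {x : HermitianMatrix q l K → K} (hx : x ∈ affineHermitianGrassmannCode q l K) (hx0 : x ≠ 0) :
    q ^ l ^ 2 ≤ hammingNorm x + (q ^ (l ^ 2 - 1) + q ^ (l ^ 2 - 3)) := by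
  obtain ⟨f, hf, rfl⟩ := hx
  obtain ⟨P, hP⟩ := Function.ne_iff.1 hx0
  have := (rankOneAffine_of_mem_minorSpace hf).hermZeros_le h hl
    ((conjTranspose_eq_iff h).1 P.2) hP
  have := hammingNorm_hermitianEval h f
  omega

theorem hammingNorm_leading_minor [DecidableEq K] (h : QuadConj q σ) {i j : Fin l}
    (hi : i.1 = 0) (hj : j.1 = 1) {I : Finset (Fin l)} (hI : I = {i, j}) :
    hammingNorm (hermitianEval q l K
      (minorDet (Matrix.mvPolynomialX (Fin l) (Fin l) K) I I rfl + 1)) +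
        (q ^ (l ^ 2 - 1) + q ^ (l ^ 2 - 3)) = q ^ l ^ 2 := by
  obtain ⟨m, rfl⟩ : ∃ m, l = m + 2 := ⟨l - 2, by have := j.2; omega⟩
  obtain rfl : i = 0 := Fin.ext hi
  obtain rfl : j = 1 := Fin.ext (by simpa using hj)
  have := hammingNorm_hermitianEval h
    (minorDet (Matrix.mvPolynomialX (Fin (m + 2)) (Fin (m + 2)) K) I I rfl + 1)
  simp only [map_add _ (minorDet _ I I rfl), map_one, aeval_minorDet] at this
  simp only [minorDet_pair (R := K) _ Fin.zero_lt_one hI, hermZeros_leading_minor h] at this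
  simpa only [map_add _ (minorDet _ I I rfl)] using this

end

theorem mainTheorem1 (q : ℕ) (hq : IsPrimePow q)
    (K : Type*) [Field K] [Fintype K] [DecidableEq K] (hK : Fintype.card K = q ^ 2)
    (l : ℕ) (hl : 2 ≤ l) :
    (minDist (affineHermitianGrassmannCode q l K : Set (HermitianMatrix q l K → K)) : ℤ) =
        (q : ℤ) ^ (l ^ 2) - (q : ℤ) ^ (l ^ 2 - 1) - (q : ℤ) ^ (l ^ 2 - 3) ∧
      ∀ I : Finset (Fin l), I = {⟨0, by omega⟩, ⟨1, by omega⟩} →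
        minorDet (Matrix.mvPolynomialX (Fin l) (Fin l) K) I I rfl + 1 ∈ minorSpace l K ∧
        (hammingNorm (hermitianEval q l K
            (minorDet (Matrix.mvPolynomialX (Fin l) (Fin l) K) I I rfl + 1)) : ℤ) =
          (q : ℤ) ^ (l ^ 2) - (q : ℤ) ^ (l ^ 2 - 1) - (q : ℤ) ^ (l ^ 2 - 3) := by
  obtain ⟨σ, h⟩ := exists_quadConj hq hK
  have hweight : ∀ I : Finset (Fin l), I = {⟨0, by omega⟩, ⟨1, by omega⟩} →
      hammingNorm (hermitianEval q l K
        (minorDet (Matrix.mvPolynomialX (Fin l) (Fin l) K) I I rfl + 1)) +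
          (q ^ (l ^ 2 - 1) + q ^ (l ^ 2 - 3)) = q ^ l ^ 2 :=
    fun I hI => hammingNorm_leading_minor h rfl rfl hI
  refine ⟨?_, fun I hI => ⟨minorDet_add_one_mem I I rfl, ?_⟩⟩
  · let d := q ^ l ^ 2 - (q ^ (l ^ 2 - 1) + q ^ (l ^ 2 - 3))
    obtain ⟨k, hk⟩ : ∃ k, l ^ 2 = k + 4 :=
      ⟨l ^ 2 - 4, (Nat.sub_add_cancel (show 4 ≤ l ^ 2 by nlinarith)).symm⟩
    have hlt : q ^ (l ^ 2 - 1) + q ^ (l ^ 2 - 3) < q ^ l ^ 2 := by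
      have h2 := h.two_le
      have hpos : 0 < q ^ (k + 1) := by positivity
      rw [hk, show k + 4 - 1 = k + 3 by omega, show k + 4 - 3 = k + 1 by omega]
      calc q ^ (k + 3) + q ^ (k + 1) = q ^ (k + 1) * (q ^ 2 + 1) := by ring
        _ < q ^ (k + 1) * q ^ 3 := by gcongr; nlinarith
        _ = q ^ (k + 4) := by ring
    have hd : minDist (affineHermitianGrassmannCode q l K : Set (HermitianMatrix q l K → K)) =
        d := by
      refine IsLeast.csInf_eq ⟨?_, ?_⟩
      · have hw := hweight _ rfl
        refine ⟨_, ⟨_, minorDet_add_one_mem _ _ rfl, rfl⟩, 0, Submodule.zero_mem _, fun h0 => ?_,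
          (hammingDist_zero_right _).trans (Nat.eq_sub_of_add_eq hw)⟩
        rw [h0, hammingNorm_zero] at hw
        omega
      · rintro _ ⟨x, hx, y, hy, hxy, rfl⟩
        have := hammingNorm_ge_of_mem_code h hl (Submodule.sub_mem _ hy hx) (sub_ne_zero.2 hxy.symm)
        rw [hammingDist_eq_hammingNorm, neg_add_eq_sub]
        omega
    rw [hd, Nat.cast_sub hlt.le]
    push_cast
    ring
  · have := congrArg (Nat.cast : ℕ → ℤ) (hweight I hI)
    push_cast at this
    linarith
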